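/- **Proposition C.1.** Let $m,n,p\in\mathbb{Z}_{>0}$ and $z\in(0,1)$. For $w>0$ let $\{\omega^{w,z}_{(i,j)} : i,j\ge 0\}$ be independent weights with $\omega^{w,z}_{(0,0)}=0$ and, for $i,j\ge 1$, $\omega^{w,z}_{(i,j)}\sim\mathrm{Exp}(1)$, $\omega^{w,z}_{(i,0)}\sim\mathrm{Exp}(w)$, $\omega^{w,z}_{(0,j)}\sim\mathrm{Exp}(1-z)$ (the argument is the rate). Let $$G^{w,z}_{m,n}=\max_{\pi}\sum_{q\in\pi}\omega^{w,z}_{q},$$ where the maximum is over the maximal totally ordered subsets $\pi$ of $\{0,\dots,m\}\times\{0,\dots,n\}$ with the coordinatewise partial order (the up-right paths from $(0,0)$ to $(m,n)$). Write $G^z_{m,n}=G^{z,z}_{m,n}$ and $M^z_{m,n}=\frac{m}{z}+\frac{n}{1-z}$. For a partition $\lambda=(\lambda_1,\dots,\lambda_{\ell(\lambda)})$ with $\#_j(\lambda)$ parts equal to $j$, put $$c_\lambda=\prod_{j\ge 1}\frac{(j!)^{-\#_j(\lambda)}}{\#_j(\lambda)!}.$$ Then $G^{w,z}_{m,n}$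 has finite moments of all orders for every $w>0$; for $1\le k\le p-1$ the function $w\mapsto \mathbf{E}[(G^{w,z}_{m,n}-M^z_{m,n})^k]$ is $p-k$ times continuously differentiable near $w=z$; and $$\mathbf{E}\big[(G^z_{m,n}-\mathbf{E}[G^z_{m,n}])^p\big]=p!\sum_{\substack{\lambda\vdash p\\ \min\lambda>1}}c_\lambda\prod_{i=1}^{\ell(\lambda)}\partial_z^{\lambda_i-1}M^z_{m,n}-\sum_{k=1}^{p-1}\binom{p}{k}\,\partial_w^{p-k}\Big|_{w=z}\mathbf{E}\big[(G^{w,z}_{m,n}-M^z_{m,n})^k\big],$$ where the first sum is over the partitions of $p$ all of whose parts are greater than $1$. -/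

import Mathlib

namespace ExpLPP

open MeasureTheory ProbabilityTheory
open scoped Nat

/-- The lattice paths from `u` to `v`: maximal (with respect to inclusion) totally ordered subsets
of the grid `{q | u ≤ q ≤ v}`, for the coordinatewise partial order. -/
def IsPath (u v : ℕ × ℕ) (π : Finset (ℕ × ℕ)) : Prop :=
  Maximal (fun σ : Finset (ℕ × ℕ) =>
    σ ⊆ Finset.Icc u v ∧ IsChain (· ≤ ·) (σ : Set (ℕ × ℕ))) π

open Classical in
/-- The finite set of all lattice paths from `u` to `v`. -/
noncomputable def paths (u v : ℕ × ℕ) : Finset (Finset (ℕ × ℕ)) :=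
  (Finset.Icc u v).powerset.filter (IsPath u v)

theorem mem_paths {u v : ℕ × ℕ} {π : Finset (ℕ × ℕ)} : π ∈ paths u v ↔ IsPath u v π := by
  classical
  simp only [paths, Finset.mem_filter, Finset.mem_powerset, and_iff_right_iff_imp]
  exact fun h => h.prop.1

theorem paths_nonempty (u v : ℕ × ℕ) : (paths u v).Nonempty := by
  have hfin : {σ : Finset (ℕ × ℕ) |
      σ ⊆ Finset.Icc u v ∧ IsChain (· ≤ ·) (σ : Set (ℕ × ℕ))}.Finite :=
    (Finset.finite_toSet (Finset.Icc u v).powerset).subset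
      fun σ hσ => Finset.mem_coe.2 (Finset.mem_powerset.2 hσ.1)
  obtain ⟨π, -, hπ⟩ := hfin.exists_le_maximal (a := ∅) (by simp)
  exact ⟨π, mem_paths.2 hπ⟩

/-- The last-passage time from the origin to `v` in the (deterministic) weight configuration `x`:
the largest total weight of a path from `(0, 0)` to `v`. -/
noncomputable def lastPassage (x : ℕ × ℕ → ℝ) (v : ℕ × ℕ) : ℝ :=
  (paths (0, 0) v).sup' (paths_nonempty (0, 0) v) fun π => ∑ q ∈ π, x q

/-- `ω` is a family of weights on the quadrant `ℕ × ℕ` for the exponential last-passage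
percolation with boundary parameters `w` and `z`: independent weights, vanishing at the origin,
of law `Exp(1)` off the axes, `Exp(w)` on the horizontal axis and `Exp(1 - z)` on the vertical
axis (the argument of `Exp` is the rate). -/
structure IsBoundaryWeights {Ω : Type*} [MeasurableSpace Ω] (P : Measure Ω) (w z : ℝ)
    (ω : ℕ × ℕ → Ω → ℝ) : Prop where
  indep : iIndepFun ω P
  origin : ∀ x, ω (0, 0) x = 0
  bulk : ∀ i j : ℕ, 0 < i → 0 < j → HasLaw (ω (i, j)) (expMeasure 1) P
  hor : ∀ i : ℕ, 0 < i → HasLaw (ω (i, 0)) (expMeasure w) P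
  ver : ∀ j : ℕ, 0 < j → HasLaw (ω (0, j)) (expMeasure (1 - z)) P

/-- The random variable `G_{m,n}`: the last-passage time from `(0, 0)` to `(m, n)` in the random
weights `ω`. -/
noncomputable def G {Ω : Type*} (ω : ℕ × ℕ → Ω → ℝ) (m n : ℕ) (x : Ω) : ℝ :=
  lastPassage (fun q => ω q x) (m, n)

/-- The function `M^z_{m,n} = m / z + n / (1 - z)`. -/
noncomputable def M (m n : ℕ) (z : ℝ) : ℝ := m / z + n / (1 - z)

/-- The Faà di Bruno coefficient `∏_j (j!)^{-#_j} / #_j!` of a partition, where `#_j` is the number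
of parts equal to `j`. Values `j` that are not parts would contribute a factor `1`. -/
noncomputable def faaDiBrunoCoeff {p : ℕ} (l : Nat.Partition p) : ℝ :=
  ∏ j ∈ l.parts.toFinset, ((j ! : ℝ) ^ l.parts.count j)⁻¹ / ((l.parts.count j)! : ℝ)

end ExpLPP

/-! Write `X` for `G - M` at `w = z` and `S` for minus the sum of the horizontal boundary weights.
Changing the rate of the `m` horizontal weights from `z` to `w` is an explicit change of measure, so
near `w = z` the `k`-th moment about `M z` is `(w / z) ^ m * E[X ^ k * exp ((w - z) * S)]`. By the
Leibniz rule and the binomial theorem, the sum over `0 ≤ k ≤ p` of `p.choose k` times the `(p -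
k)`-th derivative of this at `z` is the `p`-th derivative at `z` of `(w / z) ^ m * E[exp ((w - z) *
(X + S))]`.

This last function is explicit by Burke's property (`IsBoundaryWeights.cornerFlip`): at `w = z` the
increments of the passage time along the right side of the rectangle are independent `Exp(1 - z)`
variables, and their sum is `G + S`. The function is therefore `tiltedMass`. It equals `1` at `z`
and has logarithmic derivative `M w - M z`, so its Taylor coefficients are sums over partitions; as
the logarithmic derivative vanishes at `z`, partitions with a part `1` drop out.

For `p > 0` the term `k = 0` vanishes and the term `k = p` is the moment sought (`moment_identity`).
The case `p = 1` shows that `M z` is the mean. Exponential moments of the weights justify all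
differentiations under the integral. -/

namespace ExpLPP

open MeasureTheory ProbabilityTheory Filter Topology
open scoped Nat

/-! ### Sums over partitions and Taylor coefficients of an exponential -/

/-- The weight `∏ b_j ^ #_j / #_j!` of a multiset. -/
noncomputable def multWeight (b : ℕ → ℝ) (s : Multiset ℕ) : ℝ :=
  ∏ j ∈ s.toFinset, b j ^ s.count j / ((s.count j)! : ℝ)

theorem multWeight_eq_prod (b : ℕ → ℝ) (s : Multiset ℕ) {t : Finset ℕ} (h : s.toFinset ⊆ t) :
    multWeight b s = ∏ j ∈ t, b j ^ s.count j / ((s.count j)! : ℝ) := by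
  refine Finset.prod_subset h fun j _ hj => ?_
  rw [Multiset.mem_toFinset] at hj
  simp [Multiset.count_eq_zero_of_notMem hj]

theorem count_mul_multWeight (b : ℕ → ℝ) {s : Multiset ℕ} {a : ℕ} (h : a ∈ s) :
    (s.count a : ℝ) * multWeight b s = b a * multWeight b (s.erase a) := by
  rw [multWeight_eq_prod b s subset_rfl,
    multWeight_eq_prod b (s.erase a) (Multiset.toFinset_subset.2 (Multiset.erase_subset a s)),
    ← Finset.mul_prod_erase _ _ (Multiset.mem_toFinset.2 h),
    ← Finset.mul_prod_erase _ _ (Multiset.mem_toFinset.2 h)]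
  have h1 : ∏ j ∈ s.toFinset.erase a, b j ^ (s.erase a).count j / (((s.erase a).count j)! : ℝ) =
      ∏ j ∈ s.toFinset.erase a, b j ^ s.count j / ((s.count j)! : ℝ) := by
    refine Finset.prod_congr rfl fun j hj => ?_
    rw [Multiset.count_erase_of_ne (Finset.ne_of_mem_erase hj)]
  rw [h1, Multiset.count_erase_self]
  obtain ⟨c, hc⟩ := Nat.exists_eq_succ_of_ne_zero (Multiset.count_ne_zero.2 h)
  rw [hc]
  simp only [Nat.succ_eq_add_one, Nat.add_sub_cancel, Nat.factorial_succ, pow_succ]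
  have := Nat.factorial_ne_zero c
  push_cast
  field_simp

/-- The sum of the weights of all partitions of `p`. -/
noncomputable def partitionSum (b : ℕ → ℝ) (p : ℕ) : ℝ :=
  ∑ l : Nat.Partition p, multWeight b l.parts

theorem sum_count_mul (s : Multiset ℕ) {t : Finset ℕ} (h : s.toFinset ⊆ t) :
    ∑ j ∈ t, s.count j * j = s.sum := by
  rw [Finset.sum_multiset_count s]
  refine (Finset.sum_subset h fun j _ hj => ?_).symm
  rw [Multiset.mem_toFinset] at hj
  simp [Multiset.count_eq_zero_of_notMem hj]

/-- Removing one part `a` is a bijection from the partitions of `p` containing `a` to those of `p -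
a`, and `c * b ^ c / c! = b * (b ^ (c - 1) / (c - 1)!)`. -/
theorem sum_count_mul_multWeight (b : ℕ → ℝ) {p a : ℕ} (h1 : 1 ≤ a) (h : a ≤ p) :
    ∑ l : Nat.Partition p, (l.parts.count a : ℝ) * multWeight b l.parts =
      b a * partitionSum b (p - a) := by
  classical
  have h2 : ∑ l : Nat.Partition p, (l.parts.count a : ℝ) * multWeight b l.parts =
      ∑ l : {l : Nat.Partition p // a ∈ l.parts},
        (l.1.parts.count a : ℝ) * multWeight b l.1.parts := by
    rw [← Finset.sum_subtype (Finset.univ.filter fun l : Nat.Partition p => a ∈ l.parts)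
      (by simp) (fun l => (l.parts.count a : ℝ) * multWeight b l.parts), Finset.sum_filter_of_ne]
    intro l _ hl
    by_contra hc
    simp [Multiset.count_eq_zero_of_notMem hc] at hl
  rw [h2, partitionSum, Finset.mul_sum,
    ← Equiv.sum_comp (Nat.Partition.partitionWithPartEquiv h1 h)]
  refine Finset.sum_congr rfl fun l _ => ?_
  rw [count_mul_multWeight b l.2, Nat.Partition.partitionWithPartEquiv_apply_parts]

/-- Write `p` as the sum of the parts of each partition and exchange sums. This is the coefficient
form of `E' = B' * E` for `E = exp B`, with `B` the power series with coefficients `b j`, `j ≥ 1`.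
-/
theorem mul_partitionSum (b : ℕ → ℝ) (p : ℕ) :
    (p : ℝ) * partitionSum b p =
      ∑ i ∈ Finset.range p, (i + 1 : ℕ) * b (i + 1) * partitionSum b (p - (i + 1)) := by
  have h1 : ∀ i ∈ Finset.range p, (i + 1 : ℕ) * b (i + 1) * partitionSum b (p - (i + 1)) =
      ∑ l : Nat.Partition p, (l.parts.count (i + 1) * (i + 1) : ℕ) * multWeight b l.parts := by
    intro i hi
    rw [mul_assoc, ← sum_count_mul_multWeight b (Nat.succ_pos i) (Finset.mem_range.1 hi),
      Finset.mul_sum]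
    refine Finset.sum_congr rfl fun l _ => ?_
    push_cast
    ring
  rw [Finset.sum_congr rfl h1, Finset.sum_comm, partitionSum, Finset.mul_sum]
  refine Finset.sum_congr rfl fun l _ => ?_
  rw [← Finset.sum_mul, ← Nat.cast_sum]
  congr 2
  have h2 := sum_count_mul l.parts (t := Finset.range (p + 1)) fun j hj => ?_
  · rw [Finset.sum_range_succ', l.parts_sum] at h2
    simpa using h2.symm
  ·
    have := l.le_of_mem_parts (Multiset.mem_toFinset.1 hj)
    simp; omega

theorem faaDiBrunoCoeff_mul_prod {p : ℕ} (l : Nat.Partition p) (d : ℕ → ℝ) :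
    faaDiBrunoCoeff l * (l.parts.map d).prod =
      multWeight (fun j => d j / (j ! : ℝ)) l.parts := by
  rw [faaDiBrunoCoeff, multWeight, Finset.prod_multiset_map_count, ← Finset.prod_mul_distrib]
  refine Finset.prod_congr rfl fun j _ => ?_
  rw [div_pow]
  field_simp

/-- If `h' = f h` then the Taylor coefficients of `h` are given by a sum over partitions. -/
theorem eq_factorial_mul_partitionSum {h d : ℕ → ℝ} (h0 : h 0 = 1)
    (hs : ∀ p, h (p + 1) = ∑ i ∈ Finset.range (p + 1), (p.choose i : ℝ) * d (i + 1) * h (p - i))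
    (p : ℕ) : h p = (p ! : ℝ) * partitionSum (fun j => d j / (j ! : ℝ)) p := by
  induction p using Nat.strong_induction_on with
  | _ p ih =>
    cases p with
    | zero => simp [h0, partitionSum, multWeight]
    | succ p =>
      have h1 := mul_partitionSum (fun j => d j / (j ! : ℝ)) (p + 1)
      rw [Nat.factorial_succ, Nat.cast_mul, mul_comm ((p + 1 : ℕ) : ℝ), mul_assoc, h1, hs,
        Finset.mul_sum]
      refine Finset.sum_congr rfl fun i hi => ?_
      have hi : i ≤ p := Nat.lt_succ_iff.1 (Finset.mem_range.1 hi)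
      -- Both sides reduce to `p! / i! * d (i + 1)` times the same partition sum.
      rw [ih (p - i) (by omega), show p + 1 - (i + 1) = p - i by omega, Nat.cast_choose ℝ hi,
        Nat.factorial_succ]
      have h2 := Nat.factorial_ne_zero i
      have h3 := Nat.factorial_ne_zero (p - i)
      push_cast
      field_simp

/-! ### Iterated derivatives and differentiation under the integral -/

/-- A ladder of derivatives computes iterated derivatives. -/
theorem iteratedDeriv_of_ladder {F : ℕ → ℝ → ℝ} {s : Set ℝ} (hs : IsOpen s)
    (hF : ∀ j, ∀ u ∈ s, HasDerivAt (F j) (F (j + 1) u) u) (j : ℕ) :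
    ∀ u ∈ s, iteratedDeriv j (F 0) u = F j u := by
  induction j with
  | zero => simp
  | succ j ih =>
    intro u hu
    rw [iteratedDeriv_succ]
    have : iteratedDeriv j (F 0) =ᶠ[𝓝 u] F j := by
      filter_upwards [hs.mem_nhds hu] with v hv using ih v hv
    rw [this.deriv_eq, (hF j u hu).deriv]

theorem contDiffOn_of_ladder {F : ℕ → ℝ → ℝ} {s : Set ℝ} (hs : IsOpen s)
    (hF : ∀ j, ∀ u ∈ s, HasDerivAt (F j) (F (j + 1) u) u) (n : ℕ) :
    ∀ j, ContDiffOn ℝ n (F j) s := by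
  induction n with
  | zero =>
    intro j
    exact contDiffOn_zero.2 fun u hu => (hF j u hu).continuousAt.continuousWithinAt
  | succ n ih =>
    intro j
    rw [Nat.cast_add, Nat.cast_one, contDiffOn_succ_iff_deriv_of_isOpen hs]
    refine ⟨fun u hu => (hF j u hu).differentiableAt.differentiableWithinAt, by simp, ?_⟩
    exact (ih (j + 1)).congr fun u hu => (hF j u hu).deriv

section Parametric

variable {Ω : Type*} [MeasurableSpace Ω] {P : Measure Ω}

theorem integrable_pow_mul_exp_half [IsFiniteMeasure P] {T : Ω → ℝ} {ε : ℝ} (hε : 0 < ε)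
    (hT : Integrable (fun x => Real.exp (ε * T x)) P) (k : ℕ) :
    Integrable (fun x => |T x| ^ k * Real.exp (ε / 2 * T x)) P := by
  -- The exponent `ε / 2` is the midpoint of `0` and `ε`, where the exponential is integrable; the
  -- room on both sides absorbs the power.
  refine integrable_pow_abs_mul_exp_of_integrable_exp_mul (t := ε / 2) (by positivity) ?_ ?_ k
  · simpa using hT
  · simp

/-- A single variable `T` dominates both `X` and `S`, so on the ball of radius `ε / 2` the integrand
and its derivative have integrable bounds independent of `w`. -/
theorem hasDerivAt_integral_pow_mul_exp [IsFiniteMeasure P] {X S T : Ω → ℝ} {ε z : ℝ}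
    (hε : 0 < ε) (hT : Integrable (fun x => Real.exp (ε * T x)) P)
    (hX : AEStronglyMeasurable X P) (hS : AEStronglyMeasurable S P)
    (hXT : ∀ᵐ x ∂P, |X x| ≤ T x) (hST : ∀ᵐ x ∂P, |S x| ≤ T x) (k j : ℕ) {w : ℝ}
    (hw : w ∈ Metric.ball z (ε / 2)) :
    HasDerivAt (fun w => ∫ x, X x ^ k * S x ^ j * Real.exp ((w - z) * S x) ∂P)
      (∫ x, X x ^ k * S x ^ (j + 1) * Real.exp ((w - z) * S x) ∂P) w := by
  have hbound : ∀ j, ∀ᵐ x ∂P, ∀ v ∈ Metric.ball z (ε / 2),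
      ‖X x ^ k * S x ^ j * Real.exp ((v - z) * S x)‖ ≤
        |T x| ^ (k + j) * Real.exp (ε / 2 * T x) := by
    intro j
    filter_upwards [hXT, hST] with x hx hs v hv
    rw [norm_mul, norm_mul, norm_pow, norm_pow, Real.norm_eq_abs, Real.norm_eq_abs,
      Real.norm_eq_abs, Real.abs_exp, pow_add]
    have hT0 : |T x| = T x := abs_of_nonneg ((abs_nonneg _).trans hx)
    have hT1 : 0 ≤ T x := (abs_nonneg _).trans hx
    rw [hT0]
    have hv' : |v - z| ≤ ε / 2 := by simpa [Real.dist_eq] using (Metric.mem_ball.1 hv).le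
    have h1 : (v - z) * S x ≤ ε / 2 * T x :=
      (le_abs_self _).trans (by rw [abs_mul]; gcongr)
    gcongr
  have hmeas : ∀ j v, AEStronglyMeasurable
      (fun x => X x ^ k * S x ^ j * Real.exp ((v - z) * S x)) P := fun j v =>
    ((hX.pow k).mul (hS.pow j)).mul
      (Real.continuous_exp.comp_aestronglyMeasurable (hS.const_mul (v - z)))
  refine (hasDerivAt_integral_of_dominated_loc_of_deriv_le
    (F := fun w x => X x ^ k * S x ^ j * Real.exp ((w - z) * S x))
    (F' := fun w x => X x ^ k * S x ^ (j + 1) * Real.exp ((w - z) * S x))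
    (bound := fun x => |T x| ^ (k + (j + 1)) * Real.exp (ε / 2 * T x))
    (Metric.isOpen_ball.mem_nhds hw) (.of_forall (hmeas j)) ?_ (hmeas (j + 1) w)
    (hbound (j + 1)) (integrable_pow_mul_exp_half hε hT _) ?_).2
  · refine (integrable_pow_mul_exp_half hε hT (k + j)).mono' (hmeas j w) ?_
    filter_upwards [hbound j] with x hx using hx w hw
  · refine .of_forall fun x v _ => ?_
    have h := ((((hasDerivAt_id v).sub_const z).mul_const (S x)).exp).const_mul
      (X x ^ k * S x ^ j)
    convert! h using 1
    simp only [id]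
    ring

end Parametric

/-! ### Dynamic programming and the recursion for increments -/

section Deterministic

/-- The last-passage times, by dynamic programming. -/
noncomputable def lppRec (x : ℕ × ℕ → ℝ) : ℕ → ℕ → ℝ
  | 0, 0 => x (0, 0)
  | i + 1, 0 => lppRec x i 0 + x (i + 1, 0)
  | 0, j + 1 => lppRec x 0 j + x (0, j + 1)
  | i + 1, j + 1 => max (lppRec x i (j + 1)) (lppRec x (i + 1) j) + x (i + 1, j + 1)

theorem lppRec_left_le (x : ℕ × ℕ → ℝ) (i j : ℕ) :
    lppRec x i j + x (i + 1, j) ≤ lppRec x (i + 1) j := by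
  cases j <;> simp [lppRec]

theorem lppRec_down_le (x : ℕ × ℕ → ℝ) (i j : ℕ) :
    lppRec x i j + x (i, j + 1) ≤ lppRec x i (j + 1) := by
  cases i <;> simp [lppRec]

theorem lppRec_zero_right (x : ℕ × ℕ → ℝ) (m : ℕ) :
    lppRec x m 0 = x (0, 0) + ∑ i ∈ Finset.range m, x (i + 1, 0) := by
  induction m with
  | zero => simp [lppRec]
  | succ m ih => rw [lppRec, ih, Finset.sum_range_succ, add_assoc]

/-- A chain below `(i, j)` that does not contain `(i, j)` avoids the last column or row. -/
theorem chain_avoids {σ : Finset (ℕ × ℕ)} {i j : ℕ} (hσ : σ ⊆ Finset.Icc (0, 0) (i, j))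
    (hc : IsChain (· ≤ ·) (σ : Set (ℕ × ℕ))) (h : (i, j) ∉ σ) :
    (∀ q ∈ σ, q.1 < i) ∨ ∀ q ∈ σ, q.2 < j := by
  by_contra! hcon
  obtain ⟨⟨a, ha, hai⟩, b, hb, hbj⟩ := hcon
  have ha' := (Finset.mem_Icc.1 (hσ ha)).2
  have hb' := (Finset.mem_Icc.1 (hσ hb)).2
  have e1 : a.1 = i := le_antisymm ha'.1 hai
  have e2 : b.2 = j := le_antisymm hb'.2 hbj
  have key : a = (i, j) ∨ b = (i, j) := by
    rcases hc.total ha hb with hab | hab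
    · right; exact Prod.ext (le_antisymm hb'.1 (e1 ▸ hab.1)) e2
    · left; exact Prod.ext e1 (le_antisymm ha'.2 (e2 ▸ hab.2))
  rcases key with rfl | rfl
  exacts [h ha, h hb]

/-- Without its top corner, a chain misses the last column or the last row, so it lies in a smaller
rectangle. Nonnegative weights allow arbitrary chains in place of maximal ones. -/
theorem sum_chain_le_lppRec {x : ℕ × ℕ → ℝ} (hx : ∀ q, 0 ≤ x q) (i j : ℕ) :
    ∀ σ : Finset (ℕ × ℕ), σ ⊆ Finset.Icc (0, 0) (i, j) →
      IsChain (· ≤ ·) (σ : Set (ℕ × ℕ)) → ∑ q ∈ σ, x q ≤ lppRec x i j := by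
  induction hN : i + j using Nat.strong_induction_on generalizing i j with
  | _ N ih =>
  intro σ hσ hc
  have herase : ∑ q ∈ σ, x q ≤ ∑ q ∈ σ.erase (i, j), x q + x (i, j) := by
    by_cases h : (i, j) ∈ σ
    · rw [Finset.sum_erase_add _ _ h]
    · rw [Finset.erase_eq_of_notMem h]; linarith [hx (i, j)]
  refine herase.trans ?_
  have hσ' : σ.erase (i, j) ⊆ Finset.Icc (0, 0) (i, j) := (Finset.erase_subset _ _).trans hσ
  have hc' : IsChain (· ≤ ·) (σ.erase (i, j) : Set (ℕ × ℕ)) :=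
    hc.mono (by exact_mod_cast Finset.erase_subset _ _)
  rcases chain_avoids hσ' hc' (Finset.notMem_erase _ _) with h | h
  · rcases i with _ | i
    · have : σ.erase (0, j) = ∅ := Finset.eq_empty_of_forall_notMem fun q hq => by
        simpa using h q hq
      rw [this, Finset.sum_empty, zero_add]
      rcases j with _ | j
      · simp [lppRec]
      · have := ih j (by omega) 0 j (by omega) ∅ (by simp) (by simp)
        rw [Finset.sum_empty] at this
        rw [lppRec]; linarith
    · refine le_trans ?_ (lppRec_left_le x i j)
      gcongr
      refine ih _ (by omega) i j rfl _ (fun q hq => ?_) hc'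
      have h1 := Finset.mem_Icc.1 (hσ' hq)
      exact Finset.mem_Icc.2 ⟨h1.1, Nat.lt_succ_iff.1 (h q hq), h1.2.2⟩
  · rcases j with _ | j
    · have : σ.erase (i, 0) = ∅ := Finset.eq_empty_of_forall_notMem fun q hq => by
        simpa using h q hq
      rw [this, Finset.sum_empty, zero_add]
      rcases i with _ | i
      · simp [lppRec]
      · have := ih i (by omega) i 0 (by omega) ∅ (by simp) (by simp)
        rw [Finset.sum_empty] at this
        rw [lppRec]; linarith
    · refine le_trans ?_ (lppRec_down_le x i j)
      gcongr
      refine ih _ (by omega) i j rfl _ (fun q hq => ?_) hc'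
      have h1 := Finset.mem_Icc.1 (hσ' hq)
      exact Finset.mem_Icc.2 ⟨h1.1, h1.2.1, Nat.lt_succ_iff.1 (h q hq)⟩

theorem exists_chain_insert {x : ℕ × ℕ → ℝ} {u v : ℕ × ℕ} {r : ℝ} (huv : u < v)
    (h : ∃ σ : Finset (ℕ × ℕ), σ ⊆ Finset.Icc (0, 0) u ∧
      IsChain (· ≤ ·) (σ : Set (ℕ × ℕ)) ∧ ∑ q ∈ σ, x q = r) :
    ∃ σ : Finset (ℕ × ℕ), σ ⊆ Finset.Icc (0, 0) v ∧
      IsChain (· ≤ ·) (σ : Set (ℕ × ℕ)) ∧ ∑ q ∈ σ, x q = r + x v := by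
  obtain ⟨σ, hσ, hc, hr⟩ := h
  have hle : ∀ q ∈ σ, q ≤ u := fun q hq => (Finset.mem_Icc.1 (hσ hq)).2
  have hv : v ∉ σ := fun hv => absurd (hle v hv) (not_le_of_gt huv)
  refine ⟨insert v σ, ?_, ?_, ?_⟩
  · refine Finset.insert_subset (Finset.mem_Icc.2 ⟨by simp [Prod.le_def], le_rfl⟩) fun q hq => ?_
    exact Finset.mem_Icc.2 ⟨(Finset.mem_Icc.1 (hσ hq)).1, (hle q hq).trans huv.le⟩
  · rw [Finset.coe_insert]
    exact hc.insert fun q hq _ => Or.inr ((hle q hq).trans huv.le)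
  · rw [Finset.sum_insert hv, hr, add_comm]

theorem exists_chain_lppRec (x : ℕ × ℕ → ℝ) (i j : ℕ) :
    ∃ σ : Finset (ℕ × ℕ), σ ⊆ Finset.Icc (0, 0) (i, j) ∧
      IsChain (· ≤ ·) (σ : Set (ℕ × ℕ)) ∧ ∑ q ∈ σ, x q = lppRec x i j := by
  induction i generalizing j with
  | zero =>
    induction j with
    | zero => exact ⟨{(0, 0)}, by simp, by simp, by simp [lppRec]⟩
    | succ j ih =>
      rw [lppRec]
      exact exists_chain_insert (by simp [Prod.lt_iff]) ih
  | succ i ihi =>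
    induction j with
    | zero =>
      rw [lppRec]
      exact exists_chain_insert (by simp [Prod.lt_iff]) (ihi 0)
    | succ j ihj =>
      rw [lppRec]
      rcases max_cases (lppRec x i (j + 1)) (lppRec x (i + 1) j) with h | h
      · rw [h.1]; exact exists_chain_insert (by simp [Prod.lt_iff]) (ihi (j + 1))
      · rw [h.1]; exact exists_chain_insert (by simp [Prod.lt_iff]) ihj

/-- The recursion is attained by some chain; extending it to a maximal one cannot lower a sum of
nonnegative weights. -/
theorem lastPassage_eq_lppRec {x : ℕ × ℕ → ℝ} (hx : ∀ q, 0 ≤ x q) (m n : ℕ) :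
    lastPassage x (m, n) = lppRec x m n := by
  refine le_antisymm ?_ ?_
  · refine Finset.sup'_le _ _ fun π hπ => ?_
    have h := (mem_paths.1 hπ).prop
    exact sum_chain_le_lppRec hx m n π h.1 h.2
  · obtain ⟨σ, hσ, hc, hr⟩ := exists_chain_lppRec x m n
    have hfin : {σ : Finset (ℕ × ℕ) |
        σ ⊆ Finset.Icc (0, 0) (m, n) ∧ IsChain (· ≤ ·) (σ : Set (ℕ × ℕ))}.Finite :=
      (Finset.finite_toSet (Finset.Icc (0, 0) (m, n)).powerset).subset
        fun σ hσ => Finset.mem_coe.2 (Finset.mem_powerset.2 hσ.1)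
    obtain ⟨π, hle, hπ⟩ := hfin.exists_le_maximal (a := σ) ⟨hσ, hc⟩
    rw [← hr]
    refine (Finset.sum_le_sum_of_subset_of_nonneg hle fun q _ _ => hx q).trans ?_
    exact Finset.le_sup' (fun π => ∑ q ∈ π, x q) (mem_paths.2 hπ)

theorem lastPassage_congr {x y : ℕ × ℕ → ℝ} {v : ℕ × ℕ}
    (h : ∀ q ∈ Finset.Icc (0, 0) v, x q = y q) : lastPassage x v = lastPassage y v := by
  refine Finset.sup'_congr _ rfl fun π hπ => Finset.sum_congr rfl fun q hq => ?_
  exact h q ((mem_paths.1 hπ).prop.1 hq)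

theorem abs_lastPassage_le (x : ℕ × ℕ → ℝ) (v : ℕ × ℕ) :
    |lastPassage x v| ≤ ∑ q ∈ Finset.Icc (0, 0) v, |x q| := by
  obtain ⟨π, hπ, h⟩ := Finset.exists_mem_eq_sup' (paths_nonempty (0, 0) v) fun π => ∑ q ∈ π, x q
  rw [lastPassage, h]
  exact (Finset.abs_sum_le_sum_abs _ _).trans
    (Finset.sum_le_sum_of_subset_of_nonneg (mem_paths.1 hπ).prop.1 fun q _ _ => abs_nonneg _)

theorem measurable_lastPassage {α : Type*} [MeasurableSpace α] {f : ℕ × ℕ → α → ℝ}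
    (hf : ∀ q, Measurable (f q)) (v : ℕ × ℕ) :
    Measurable fun a => lastPassage (fun q => f q a) v := by
  have := Finset.measurable_sup' (paths_nonempty (0, 0) v) (f := fun π a => ∑ q ∈ π, f q a)
    fun π _ => Finset.measurable_fun_sum π fun q _ => hf q
  convert this using 1
  ext a
  rw [Finset.sup'_apply, lastPassage]

/-- The local update at the corner `(a, b)`: the slots `(a, 0)` and `(0, b)` hold the increments
below and to the left of the corner, and are replaced by those above and to its right. -/
noncomputable def cornerFlip (a b : ℕ) (y : ℕ × ℕ → ℝ) (q : ℕ × ℕ) : ℝ :=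
  if q = (a, 0) then y (a, b) + y (a, 0) - min (y (a, 0)) (y (0, b))
  else if q = (0, b) then y (a, b) + y (0, b) - min (y (a, 0)) (y (0, b))
  else if q = (a, b) then min (y (a, 0)) (y (0, b))
  else y q

/-- Successive updates along the column `a`, up to the row `k`. -/
noncomputable def columnFlip (a : ℕ) : ℕ → (ℕ × ℕ → ℝ) → ℕ × ℕ → ℝ
  | 0, y => y
  | k + 1, y => cornerFlip a (k + 1) (columnFlip a k y)

/-- Successive updates along the first columns, up to the row `n`. -/
noncomputable def gridFlip (n : ℕ) : ℕ → (ℕ × ℕ → ℝ) → ℕ × ℕ → ℝ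
  | 0, y => y
  | i + 1, y => columnFlip (i + 1) n (gridFlip n i y)

/-- Invariant of the sweep: the slot on the horizontal axis carries the horizontal increment at the
current height `k`, and the slots on the vertical axis carry the vertical increments of the new
column below that height and of the old column above it. Weights not yet reached are intact. -/
theorem columnFlip_spec {x y : ℕ × ℕ → ℝ} {n i : ℕ}
    (hJ : ∀ j < n, y (0, j + 1) = lppRec x i (j + 1) - lppRec x i j)
    (hy : ∀ a b, i < a → y (a, b) = x (a, b)) (k : ℕ) (hk : k ≤ n) :
    columnFlip (i + 1) k y (i + 1, 0) = lppRec x (i + 1) k - lppRec x i k ∧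
    (∀ j < k, columnFlip (i + 1) k y (0, j + 1) = lppRec x (i + 1) (j + 1) - lppRec x (i + 1) j) ∧
    (∀ j < n, k ≤ j → columnFlip (i + 1) k y (0, j + 1) = lppRec x i (j + 1) - lppRec x i j) ∧
    (∀ b, k < b → columnFlip (i + 1) k y (i + 1, b) = x (i + 1, b)) ∧
    ∀ a b, i + 1 < a → columnFlip (i + 1) k y (a, b) = x (a, b) := by
  induction k with
  | zero =>
    refine ⟨?_, by simp, fun j hj _ => hJ j hj, fun b _ => hy _ _ (by omega),
      fun a b h => hy _ _ (by omega)⟩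
    simp [columnFlip, hy, lppRec]
  | succ k ih =>
    obtain ⟨h1, h2, h3, h4, h5⟩ := ih (by omega)
    have e1 := h3 k (by omega) le_rfl
    have e2 := h4 (k + 1) (by omega)
    -- This turns the `max` of the passage-time recursion into the `min` of the corner update.
    have hmax : ∀ u v g : ℝ, min (u - g) (v - g) = u + v - max u v - g := fun u v g => by
      rcases le_total u v with h | h
      · rw [max_eq_right h, min_eq_left (by linarith)]; ring
      · rw [max_eq_left h, min_eq_right (by linarith)]; ring
    have e3 : lppRec x (i + 1) (k + 1) =
      max (lppRec x i (k + 1)) (lppRec x (i + 1) k) + x (i + 1, k + 1) := by rw [lppRec]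
    refine ⟨?_, fun j hj => ?_, fun j hj hkj => ?_, fun b hb => ?_, fun a b hab => ?_⟩
    · simp only [columnFlip, cornerFlip, if_true]
      rw [h1, e1, e2, hmax, e3, max_comm]; ring
    · rcases Nat.lt_succ_iff_lt_or_eq.1 hj with hj' | rfl
      · simp [columnFlip, cornerFlip, hj'.ne, h2 j hj']
      · simp only [columnFlip, cornerFlip]
        rw [if_neg (by simp), if_pos trivial, h1, e1, e2, hmax, e3, max_comm]; ring
    · simp only [columnFlip, cornerFlip]
      rw [if_neg (by simp), if_neg (by simp; omega), if_neg (by simp), h3 j hj (by omega)]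
    · simp only [columnFlip, cornerFlip]
      rw [if_neg (by simp; omega), if_neg (by simp), if_neg (by simp; omega), h4 b (by omega)]
    · simp only [columnFlip, cornerFlip]
      rw [if_neg (by simp; omega), if_neg (by simp; omega), if_neg (by simp; omega), h5 a b hab]

theorem gridFlip_spec {x : ℕ × ℕ → ℝ} (n i : ℕ) :
    (∀ j < n, gridFlip n i x (0, j + 1) = lppRec x i (j + 1) - lppRec x i j) ∧
    ∀ a b, i < a → gridFlip n i x (a, b) = x (a, b) := by
  induction i with
  | zero => exact ⟨fun j _ => by simp [gridFlip, lppRec], fun a b _ => rfl⟩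
  | succ i ih =>
    obtain ⟨-, h2, -, -, h5⟩ := columnFlip_spec ih.1 ih.2 n le_rfl
    exact ⟨h2, h5⟩

theorem sum_gridFlip (x : ℕ × ℕ → ℝ) (m n : ℕ) :
    ∑ j ∈ Finset.range n, gridFlip n m x (0, j + 1) = lppRec x m n - lppRec x m 0 := by
  rw [← Finset.sum_range_sub (fun j => lppRec x m j) n]
  exact Finset.sum_congr rfl fun j hj => (gridFlip_spec n m).1 j (Finset.mem_range.1 hj)

end Deterministic

/-! ### Burke's property at one corner -/

section Burke

/-- The local update of the two increments and the weight at a corner. -/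
noncomputable def flipMap (p : (ℝ × ℝ) × ℝ) : (ℝ × ℝ) × ℝ :=
  ((p.2 + p.1.1 - min p.1.1 p.1.2, p.2 + p.1.2 - min p.1.1 p.1.2), min p.1.1 p.1.2)

theorem measurePreserving_sub_min :
    MeasurePreserving (fun p : ℝ × ℝ => (p.1 - p.2, min p.1 p.2)) := by
  have h1 : MeasurePreserving (fun p : ℝ × ℝ => (p.1, p.2 + min p.1 0)) :=
    (MeasurePreserving.id (volume : Measure ℝ)).skew_product
      (g := fun d t => t + min d 0) (by fun_prop)
      (.of_forall fun d => map_add_right_eq_self volume (min d 0))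
  convert h1.comp (measurePreserving_sub_prod (volume : Measure ℝ) (volume : Measure ℝ)) using 1
  ext p
  · rfl
  · rcases le_total p.1 p.2 with h | h <;> simp [h]
  · rfl

theorem measurePreserving_add_max :
    MeasurePreserving (fun p : ℝ × ℝ => (p.2 + max p.1 0, p.2 + max (-p.1) 0)) := by
  have h1 : MeasurePreserving (fun p : ℝ × ℝ => (p.1, p.2 + max (-p.1) 0)) :=
    (MeasurePreserving.id (volume : Measure ℝ)).skew_product
      (g := fun d t => t + max (-d) 0) (by fun_prop)
      (.of_forall fun d => map_add_right_eq_self volume (max (-d) 0))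
  convert (measurePreserving_add_prod (volume : Measure ℝ) (volume : Measure ℝ)).comp h1 using 1
  ext p
  · rcases le_total p.1 0 with h | h <;> simp [h]
    ring
  · rfl
  · rfl

/-- With `d = u - v` and `s = min u v`, the update sends `(u, v, t)` to `(t + d⁺, t + d⁻, s)`. It is
thus `(u, v) ↦ (d, s)`, an exchange of coordinates, and `(d, t) ↦ (t + d⁺, t + d⁻)`; both planar
maps are compositions of shears. -/
theorem measurePreserving_flipMap : MeasurePreserving flipMap := by
  have hid := MeasurePreserving.id (volume : Measure ℝ)
  have hassoc := measurePreserving_prodAssoc (volume : Measure ℝ) (volume : Measure ℝ)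
    (volume : Measure ℝ)
  have hswap : MeasurePreserving (fun p : (ℝ × ℝ) × ℝ => ((p.1.1, p.2), p.1.2)) :=
    (hassoc.symm MeasurableEquiv.prodAssoc).comp
      ((hid.prod Measure.measurePreserving_swap).comp hassoc)
  convert (measurePreserving_add_max.prod hid).comp
    (hswap.comp (measurePreserving_sub_min.prod hid)) using 1
  ext p
  · rcases le_total p.1.1 p.1.2 with h | h <;> simp [flipMap, h]
    ring
  · rcases le_total p.1.1 p.1.2 with h | h <;> simp [flipMap, h]
    ring
  · rfl
  · rfl
  · rfl

theorem _root_.MeasureTheory.MeasurePreserving.withDensity_comp {α β : Type*} [MeasurableSpace α]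
    [MeasurableSpace β] {μ : Measure α} {ν : Measure β} {f : α → β} (hf : MeasurePreserving f μ ν)
    {ρ : β → ENNReal} (hρ : Measurable ρ) :
    MeasurePreserving f (μ.withDensity (ρ ∘ f)) (ν.withDensity ρ) := by
  refine ⟨hf.measurable, Measure.ext fun s hs => ?_⟩
  rw [Measure.map_apply hf.measurable hs, withDensity_apply _ (hf.measurable hs),
    withDensity_apply _ hs]
  exact hf.setLIntegral_comp_preimage hs hρ

theorem expMeasure_eq (r : ℝ) : expMeasure r = volume.withDensity (exponentialPDF r) := rfl

@[fun_prop]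
theorem measurable_exponentialPDF (r : ℝ) : Measurable (exponentialPDF r) :=
  (measurable_exponentialPDFReal r).ennreal_ofReal

/-- The joint law of the increments and the weight at a corner. -/
noncomputable def cornerLaw (z : ℝ) : Measure ((ℝ × ℝ) × ℝ) :=
  ((expMeasure z).prod (expMeasure (1 - z))).prod (expMeasure 1)

/-- The linear form `z * u + (1 - z) * v + t` is invariant because the two boundary rates add up to
the bulk rate `1`; the nonnegative octant is invariant as well. -/
theorem exponentialPDF_flipMap {z : ℝ} (hz : z ∈ Set.Ioo (0 : ℝ) 1) (p : (ℝ × ℝ) × ℝ) :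
    exponentialPDF z (flipMap p).1.1 * exponentialPDF (1 - z) (flipMap p).1.2 *
        exponentialPDF 1 (flipMap p).2 =
      exponentialPDF z p.1.1 * exponentialPDF (1 - z) p.1.2 * exponentialPDF 1 p.2 := by
  obtain ⟨⟨u, v⟩, t⟩ := p
  simp only [flipMap]
  by_cases h : 0 ≤ u ∧ 0 ≤ v ∧ 0 ≤ t
  · obtain ⟨hu, hv, ht⟩ := h
    have h1 : min u v ≤ u := min_le_left _ _
    have h2 : min u v ≤ v := min_le_right _ _
    rw [exponentialPDF_of_nonneg hu, exponentialPDF_of_nonneg hv, exponentialPDF_of_nonneg ht,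
      exponentialPDF_of_nonneg (by linarith), exponentialPDF_of_nonneg (by linarith),
      exponentialPDF_of_nonneg (le_min hu hv)]
    have hz1 : 0 < 1 - z := sub_pos.2 hz.2
    have hz0 := hz.1
    rw [← ENNReal.ofReal_mul (by positivity), ← ENNReal.ofReal_mul (by positivity),
      ← ENNReal.ofReal_mul (by positivity), ← ENNReal.ofReal_mul (by positivity)]
    congr 1
    have key : ∀ a b c : ℝ, z * Real.exp a * ((1 - z) * Real.exp b) * (1 * Real.exp c) =
        z * (1 - z) * Real.exp (a + b + c) := fun a b c => by
      rw [Real.exp_add, Real.exp_add]; ring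
    rw [key, key]
    ring_nf
  · have hL : u < 0 ∨ v < 0 ∨ t < 0 := by
      by_contra! hcon
      exact h hcon
    have hR : t + u - min u v < 0 ∨ t + v - min u v < 0 ∨ min u v < 0 := by
      by_contra! hcon
      obtain ⟨h1, h2, h3⟩ := hcon
      refine h ⟨h3.trans (min_le_left _ _), h3.trans (min_le_right _ _), ?_⟩
      rcases min_choice u v with h4 | h4 <;> rw [h4] at h1 h2 <;> linarith
    have e : ∀ a b c : ℝ, a < 0 ∨ b < 0 ∨ c < 0 →
        exponentialPDF z a * exponentialPDF (1 - z) b * exponentialPDF 1 c = 0 := by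
      rintro a b c (h | h | h) <;> simp [exponentialPDF_of_neg h]
    rw [e _ _ _ hL, e _ _ _ hR]

theorem cornerLaw_eq {z : ℝ} (hz : z ∈ Set.Ioo (0 : ℝ) 1) :
    cornerLaw z = volume.withDensity fun p : (ℝ × ℝ) × ℝ =>
      exponentialPDF z p.1.1 * exponentialPDF (1 - z) p.1.2 * exponentialPDF 1 p.2 := by
  have := isProbabilityMeasure_expMeasure hz.1
  have := isProbabilityMeasure_expMeasure (sub_pos.2 hz.2)
  have := isProbabilityMeasure_expMeasure one_pos
  rw [cornerLaw]
  rw [expMeasure_eq] at *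
  rw [expMeasure_eq] at *
  rw [expMeasure_eq] at *
  rw [prod_withDensity (by fun_prop) (by fun_prop), prod_withDensity (by fun_prop) (by fun_prop)]
  rfl

theorem measurePreserving_flipMap_cornerLaw {z : ℝ} (hz : z ∈ Set.Ioo (0 : ℝ) 1) :
    MeasurePreserving flipMap (cornerLaw z) (cornerLaw z) := by
  have h := measurePreserving_flipMap.withDensity_comp
    (ρ := fun p : (ℝ × ℝ) × ℝ =>
      exponentialPDF z p.1.1 * exponentialPDF (1 - z) p.1.2 * exponentialPDF 1 p.2)
    (by fun_prop)
  rw [cornerLaw_eq hz]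
  convert! h using 1
  exact congrArg _ (funext fun p => (exponentialPDF_flipMap hz p).symm)

end Burke

/-! ### Stationarity of the boundary weights under the updates -/

section Weights

variable {Ω : Type*} [MeasurableSpace Ω] {P : Measure Ω}

/-- The law of the weight at `q`. -/
noncomputable def weightLaw (w z : ℝ) (q : ℕ × ℕ) : Measure ℝ :=
  if q.2 = 0 then if q.1 = 0 then Measure.dirac 0 else expMeasure w
  else if q.1 = 0 then expMeasure (1 - z) else expMeasure 1

theorem isProbabilityMeasure_weightLaw {w z : ℝ} (hw : 0 < w) (hz : z < 1) (q : ℕ × ℕ) :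
    IsProbabilityMeasure (weightLaw w z q) := by
  unfold weightLaw
  split_ifs
  · infer_instance
  · exact isProbabilityMeasure_expMeasure hw
  · exact isProbabilityMeasure_expMeasure (sub_pos.2 hz)
  · exact isProbabilityMeasure_expMeasure one_pos

theorem IsBoundaryWeights.hasLaw {w z : ℝ} {ω : ℕ × ℕ → Ω → ℝ}
    (h : IsBoundaryWeights P w z ω) [IsProbabilityMeasure P] (q : ℕ × ℕ) :
    HasLaw (ω q) (weightLaw w z q) P := by
  obtain ⟨i, j⟩ := q
  rcases Nat.eq_zero_or_pos i with rfl | hi <;> rcases Nat.eq_zero_or_pos j with rfl | hj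
  · have : ω (0, 0) = fun _ => 0 := funext h.origin
    rw [this]
    refine ⟨aemeasurable_const, ?_⟩
    simp [weightLaw, Measure.map_const]
  · simpa [weightLaw, hj.ne'] using h.ver j hj
  · simpa [weightLaw, hi.ne'] using h.hor i hi
  · simpa [weightLaw, hi.ne', hj.ne'] using h.bulk i j hi hj

theorem IsBoundaryWeights.aemeasurable {w z : ℝ} {ω : ℕ × ℕ → Ω → ℝ}
    (h : IsBoundaryWeights P w z ω) [IsProbabilityMeasure P] (q : ℕ × ℕ) :
    AEMeasurable (ω q) P := (h.hasLaw q).aemeasurable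

theorem IsBoundaryWeights.hasLaw_corner {z : ℝ} {ω : ℕ × ℕ → Ω → ℝ}
    (hz : z ∈ Set.Ioo (0 : ℝ) 1) (h : IsBoundaryWeights P z z ω) [IsProbabilityMeasure P]
    {a b : ℕ} (ha : 0 < a) (hb : 0 < b) :
    HasLaw (fun x => ((ω (a, 0) x, ω (0, b) x), ω (a, b) x)) (cornerLaw z) P := by
  have := isProbabilityMeasure_expMeasure hz.1
  have := isProbabilityMeasure_expMeasure (sub_pos.2 hz.2)
  have := isProbabilityMeasure_expMeasure one_pos
  refine IndepFun.hasLaw_prod (IndepFun.hasLaw_prod (h.hor a ha) (h.ver b hb) ?_)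
    (h.bulk a b ha hb) ?_
  · exact h.indep.indepFun (by simp [ha.ne'])
  · exact h.indep.indepFun_prodMk₀ h.aemeasurable _ _ _ (by simp [hb.ne]) (by simp [ha.ne])

/-- Only three weights change. They are a function of the old triple, hence independent of all the
others, and their joint law is again the product `cornerLaw z`. -/
theorem IsBoundaryWeights.cornerFlip {z : ℝ} {ω : ℕ × ℕ → Ω → ℝ}
    (hz : z ∈ Set.Ioo (0 : ℝ) 1) (h : IsBoundaryWeights P z z ω) [IsProbabilityMeasure P]
    {a b : ℕ} (ha : 0 < a) (hb : 0 < b) :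
    IsBoundaryWeights P z z fun q x => cornerFlip a b (fun q => ω q x) q := by
  have := isProbabilityMeasure_expMeasure hz.1
  have := isProbabilityMeasure_expMeasure (sub_pos.2 hz.2)
  have := isProbabilityMeasure_expMeasure one_pos
  set W : Ω → (ℝ × ℝ) × ℝ := fun x => ((ω (a, 0) x, ω (0, b) x), ω (a, b) x) with hW
  have hlawW : HasLaw W (cornerLaw z) P := h.hasLaw_corner hz ha hb
  have hlaw : HasLaw (flipMap ∘ W) (cornerLaw z) P :=
    (measurePreserving_flipMap_cornerLaw hz).comp_hasLaw hlawW
  set ω' : ℕ × ℕ → Ω → ℝ := fun q x => ExpLPP.cornerFlip a b (fun q => ω q x) q with hω'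
  have e1 : ω' (a, 0) = fun x => (flipMap (W x)).1.1 := by
    ext x; simp [hω', ExpLPP.cornerFlip, flipMap, hW]
  have e2 : ω' (0, b) = fun x => (flipMap (W x)).1.2 := by
    ext x; simp [hω', ExpLPP.cornerFlip, flipMap, hW, ha.ne]
  have e3 : ω' (a, b) = fun x => (flipMap (W x)).2 := by
    ext x; simp [hω', ExpLPP.cornerFlip, flipMap, hW, ha.ne', hb.ne']
  have e4 : ∀ q, q ≠ (a, 0) → q ≠ (0, b) → q ≠ (a, b) → ω' q = ω q := by
    intro q h1 h2 h3
    ext x; simp [hω', ExpLPP.cornerFlip, h1, h2, h3]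
  have l1 : HasLaw (ω' (a, 0)) (expMeasure z) P := by
    rw [e1]
    exact measurePreserving_fst.comp_hasLaw (measurePreserving_fst.comp_hasLaw hlaw)
  have l2 : HasLaw (ω' (0, b)) (expMeasure (1 - z)) P := by
    rw [e2]
    exact measurePreserving_snd.comp_hasLaw (measurePreserving_fst.comp_hasLaw hlaw)
  have l3 : HasLaw (ω' (a, b)) (expMeasure 1) P := by
    rw [e3]
    exact measurePreserving_snd.comp_hasLaw hlaw
  refine ⟨?_, fun x => ?_, fun i j hi hj => ?_, fun i hi => ?_, fun j hj => ?_⟩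
  · rw [iIndepFun_iff_measure_inter_preimage_eq_mul]
    intro s B hB
    classical
    set T : Finset (ℕ × ℕ) := {(a, 0), (0, b), (a, b)} with hT
    -- Taking the whole line outside `s` lets the index set be enlarged to contain all three corner
    -- slots without changing event or product.
    set B' : ℕ × ℕ → Set ℝ := fun q => if q ∈ s then B q else Set.univ with hB'
    have hBm : ∀ q, MeasurableSet (B' q) := fun q => by
      by_cases hq : q ∈ s
      · simp only [hB', if_pos hq]; exact hB q hq
      · simp only [hB', if_neg hq]; exact .univ
    have hTne : ∀ q ∉ T, ω' q = ω q := fun q hq => by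
      simp only [hT, Finset.mem_insert, Finset.mem_singleton, not_or] at hq
      exact e4 q hq.1 hq.2.1 hq.2.2
    set C : Set ((ℝ × ℝ) × ℝ) := (B' (a, 0) ×ˢ B' (0, b)) ×ˢ B' (a, b) with hC
    have hCm : MeasurableSet C := ((hBm _).prod (hBm _)).prod (hBm _)
    set V : Ω → ((s \ T : Finset (ℕ × ℕ)) → ℝ) := fun x q => ω q x with hV
    have hind : IndepFun W V P := by
      have h0 := h.indep.indepFun_finset₀ T (s \ T) Finset.disjoint_sdiff h.aemeasurable
      have hm : Measurable fun t : T → ℝ => ((t ⟨(a, 0), by simp [hT]⟩,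
          t ⟨(0, b), by simp [hT]⟩), t ⟨(a, b), by simp [hT]⟩) := by fun_prop
      exact h0.comp hm measurable_id
    have hset : ⋂ q ∈ s, ω' q ⁻¹' B q =
        W ⁻¹' (flipMap ⁻¹' C) ∩ V ⁻¹' (Set.univ.pi fun q => B q) := by
      have hs1 : ⋂ q ∈ s, ω' q ⁻¹' B q = ⋂ q ∈ T ∪ s \ T, ω' q ⁻¹' B' q := by
        ext x
        simp only [Set.mem_iInter, Finset.union_sdiff_self_eq_union, Finset.mem_union,
          Set.mem_preimage, hB']
        refine ⟨fun hx q _ => ?_, fun hx q hq => ?_⟩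
        · by_cases hq : q ∈ s
          · simpa [hq] using hx q hq
          · simp [hq]
        · simpa [hq] using hx q (Or.inr hq)
      rw [hs1]
      ext x
      simp only [Finset.mem_union, Set.mem_iInter, or_imp, forall_and, Set.mem_inter_iff]
      refine and_congr ?_ ?_
      · simp [hT, e1, e2, e3, hC, Set.mem_prod, and_assoc]
      · simp only [Set.mem_preimage, Set.mem_pi, Set.mem_univ, true_imp_iff, Subtype.forall]
        refine forall₂_congr fun q hq => ?_
        have hq' := Finset.mem_sdiff.1 hq
        rw [hTne q hq'.2]
        simp [hB', hq'.1, hV]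
    have hprod : ∏ q ∈ s, P (ω' q ⁻¹' B q) =
        (∏ q ∈ T, P (ω' q ⁻¹' B' q)) * ∏ q ∈ s \ T, P (ω q ⁻¹' B q) := by
      have h1 : ∏ q ∈ s \ T, P (ω q ⁻¹' B q) = ∏ q ∈ s \ T, P (ω' q ⁻¹' B' q) :=
        Finset.prod_congr rfl fun q hq => by
          rw [Finset.mem_sdiff] at hq
          rw [hTne q hq.2]; simp [hB', hq.1]
      rw [h1, ← Finset.prod_union Finset.disjoint_sdiff, Finset.union_sdiff_self_eq_union]
      have h2 : ∏ q ∈ s, P (ω' q ⁻¹' B q) = ∏ q ∈ s, P (ω' q ⁻¹' B' q) :=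
        Finset.prod_congr rfl fun q hq => by simp [hB', hq]
      rw [h2]
      refine Finset.prod_subset Finset.subset_union_right fun q _ hq => ?_
      simp [hB', hq]
    have hVm : P (V ⁻¹' (Set.univ.pi fun q => B q)) = ∏ q ∈ s \ T, P (ω q ⁻¹' B q) := by
      rw [← h.indep.measure_inter_preimage_eq_mul (s \ T)
        fun q hq => hB q (Finset.mem_sdiff.1 hq).1]
      congr 1
      ext x
      simp [hV]
    have hWm : P (W ⁻¹' (flipMap ⁻¹' C)) = ∏ q ∈ T, P (ω' q ⁻¹' B' q) := by
      rw [← Set.preimage_comp, ← Measure.map_apply_of_aemeasurable hlaw.aemeasurable hCm,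
        hlaw.map_eq, hC, cornerLaw, Measure.prod_prod, Measure.prod_prod, hT,
        Finset.prod_insert (by simp [ha.ne', hb.ne]), Finset.prod_insert (by simp [ha.ne]),
        Finset.prod_singleton, ← l1.map_eq, ← l2.map_eq, ← l3.map_eq,
        Measure.map_apply_of_aemeasurable l1.aemeasurable (hBm _),
        Measure.map_apply_of_aemeasurable l2.aemeasurable (hBm _),
        Measure.map_apply_of_aemeasurable l3.aemeasurable (hBm _), mul_assoc]
    rw [hset, hind.measure_inter_preimage_eq_mul _ _
      (measurePreserving_flipMap.measurable hCm) ?_, hWm, hVm, hprod]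
    exact MeasurableSet.univ_pi fun q => hB q (Finset.mem_sdiff.1 q.2).1
  · rw [e4 (0, 0) (by simp [ha.ne]) (by simp [hb.ne]) (by simp [ha.ne])]
    exact h.origin x
  · by_cases hq : (i, j) = (a, b)
    · rw [hq]; exact l3
    · rw [e4 _ (by simp [hj.ne']) (by simp [hi.ne']) hq]; exact h.bulk i j hi hj
  · by_cases hq : (i, 0) = (a, 0)
    · rw [hq]; exact l1
    · rw [e4 _ hq (by simp [hb.ne]) (by simp [hb.ne])]; exact h.hor i hi
  · by_cases hq : (0, j) = (0, b)
    · rw [hq]; exact l2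
    · rw [e4 _ (by simp [ha.ne]) hq (by simp [ha.ne])]; exact h.ver j hj

theorem IsBoundaryWeights.columnFlip {z : ℝ} {ω : ℕ × ℕ → Ω → ℝ}
    (hz : z ∈ Set.Ioo (0 : ℝ) 1) (h : IsBoundaryWeights P z z ω) [IsProbabilityMeasure P]
    {a : ℕ} (ha : 0 < a) (k : ℕ) :
    IsBoundaryWeights P z z fun q x => columnFlip a k (fun q => ω q x) q := by
  induction k with
  | zero => exact h
  | succ k ih => exact ih.cornerFlip hz ha (Nat.succ_pos k)

theorem IsBoundaryWeights.gridFlip {z : ℝ} {ω : ℕ × ℕ → Ω → ℝ}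
    (hz : z ∈ Set.Ioo (0 : ℝ) 1) (h : IsBoundaryWeights P z z ω) [IsProbabilityMeasure P]
    (n i : ℕ) : IsBoundaryWeights P z z fun q x => gridFlip n i (fun q => ω q x) q := by
  induction i with
  | zero => exact h
  | succ i ih => exact ih.columnFlip hz (Nat.succ_pos i) n

end Weights

/-! ### Exponential laws under a change of rate -/

section Exponential

theorem expMeasure_eq_withDensity {r : ℝ} (hr : 0 < r) (w : ℝ) :
    expMeasure w =
      (expMeasure r).withDensity fun x => ENNReal.ofReal (w / r * Real.exp (-(w - r) * x)) := by
  rw [expMeasure_eq r, ← withDensity_mul _ (by fun_prop) (by fun_prop), expMeasure_eq w]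
  congr 1
  ext x
  rw [Pi.mul_apply]
  rcases le_or_gt 0 x with hx | hx
  · rw [exponentialPDF_of_nonneg hx, exponentialPDF_of_nonneg hx,
      ← ENNReal.ofReal_mul (by positivity)]
    congr 1
    rw [mul_mul_mul_comm, ← Real.exp_add, mul_div_cancel₀ _ hr.ne']
    ring_nf
  · simp [exponentialPDF_of_neg hx]

theorem ae_nonneg_expMeasure (r : ℝ) : ∀ᵐ x ∂expMeasure r, 0 ≤ x := by
  rw [expMeasure_eq, ae_withDensity_iff (by fun_prop)]
  refine .of_forall fun x hx => ?_
  by_contra h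
  exact hx (exponentialPDF_of_neg (not_le.1 h))

/-- Tilting `Exp(r)` by `exp (t * x)` gives, up to normalization, `Exp(r - t)`; total mass `1`
yields the constant. -/
theorem lintegral_exp_expMeasure {r t : ℝ} (hr : 0 < r) (ht : t < r) :
    ∫⁻ x, ENNReal.ofReal (Real.exp (t * x)) ∂expMeasure r = ENNReal.ofReal (r / (r - t)) := by
  have hw : 0 < r - t := sub_pos.2 ht
  have h := (isProbabilityMeasure_expMeasure hw).measure_univ
  rw [expMeasure_eq_withDensity hr (r - t), withDensity_apply _ .univ, Measure.restrict_univ] at h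
  have e : ∀ x, ENNReal.ofReal ((r - t) / r * Real.exp (-(r - t - r) * x)) =
      ENNReal.ofReal ((r - t) / r) * ENNReal.ofReal (Real.exp (t * x)) := fun x => by
    rw [← ENNReal.ofReal_mul (by positivity)]
    ring_nf
  simp_rw [e] at h
  rw [lintegral_const_mul _ (by fun_prop)] at h
  rw [ENNReal.eq_inv_of_mul_eq_one_left ((mul_comm _ _).trans h), ← ENNReal.ofReal_inv_of_pos
    (by positivity), inv_div]

theorem integrable_exp_expMeasure {r t : ℝ} (hr : 0 < r) (ht : t < r) :
    Integrable (fun x => Real.exp (t * x)) (expMeasure r) := by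
  refine ⟨by fun_prop, ?_⟩
  rw [hasFiniteIntegral_iff_ofReal (.of_forall fun x => (Real.exp_pos _).le),
    lintegral_exp_expMeasure hr ht]
  exact ENNReal.ofReal_lt_top

theorem integral_exp_expMeasure {r t : ℝ} (hr : 0 < r) (ht : t < r) :
    ∫ x, Real.exp (t * x) ∂expMeasure r = r / (r - t) := by
  rw [integral_eq_lintegral_of_nonneg_ae (.of_forall fun x => (Real.exp_pos _).le) (by fun_prop),
    lintegral_exp_expMeasure hr ht, ENNReal.toReal_ofReal]
  have := sub_pos.2 ht
  positivity

end Exponential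

/-- On a box the density times the indicator is a product of functions of independent coordinates,
so its integral factors. -/
theorem _root_.MeasureTheory.Measure.pi_withDensity {ι : Type*} [Fintype ι] {α : ι → Type*}
    [∀ i, MeasurableSpace (α i)] {μ : ∀ i, Measure (α i)} [∀ i, IsProbabilityMeasure (μ i)]
    {f : ∀ i, α i → ENNReal} (hf : ∀ i, Measurable (f i))
    [∀ i, SigmaFinite ((μ i).withDensity (f i))] :
    Measure.pi (fun i => (μ i).withDensity (f i)) =
      (Measure.pi μ).withDensity fun x => ∏ i, f i (x i) := by
  refine Measure.pi_eq fun s hs => ?_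
  have hm : ∀ i, Measurable ((s i).indicator (f i)) := fun i => (hf i).indicator (hs i)
  rw [withDensity_apply _ (.univ_pi hs), ← lintegral_indicator (.univ_pi hs)]
  have h1 : ∀ x : ∀ i, α i, (Set.univ.pi s).indicator (fun x => ∏ i, f i (x i)) x =
      ∏ i, (s i).indicator (f i) (x i) := by
    intro x
    by_cases hx : x ∈ Set.univ.pi s
    · rw [Set.indicator_of_mem hx]
      exact Finset.prod_congr rfl fun i _ => (Set.indicator_of_mem (hx i trivial) _).symm
    · rw [Set.indicator_of_notMem hx]
      simp only [Set.mem_pi, Set.mem_univ, true_imp_iff, not_forall] at hx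
      obtain ⟨i, hi⟩ := hx
      exact (Finset.prod_eq_zero (Finset.mem_univ i) (Set.indicator_of_notMem hi _)).symm
  simp_rw [h1]
  rw [lintegral_prod_eq_prod_lintegral_of_indepFun Finset.univ _
    (iIndepFun_pi (X := fun i => (s i).indicator (f i)) fun i => (hm i).aemeasurable)
    fun i => (hm i).comp (measurable_pi_apply i)]
  refine Finset.prod_congr rfl fun i _ => ?_
  rw [withDensity_apply _ (hs i), ← lintegral_indicator (hs i)]
  exact (measurePreserving_eval μ i).lintegral_comp (hm i)

/-! ### Moments of the passage time and the change of measure -/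

section Moments

variable {Ω : Type*} [MeasurableSpace Ω] {P : Measure Ω} [IsProbabilityMeasure P]

theorem ae_nonneg_weightLaw (w z : ℝ) (q : ℕ × ℕ) : ∀ᵐ x ∂weightLaw w z q, 0 ≤ x := by
  unfold weightLaw
  split_ifs
  · simp
  all_goals exact ae_nonneg_expMeasure _

theorem IsBoundaryWeights.ae_nonneg {w z : ℝ} {ω : ℕ × ℕ → Ω → ℝ}
    (h : IsBoundaryWeights P w z ω) : ∀ᵐ x ∂P, ∀ q, 0 ≤ ω q x := by
  rw [ae_all_iff]
  exact fun q => ((h.hasLaw q).ae_iff (p := fun x => 0 ≤ x)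
    (measurableSet_setOfPred.1 measurableSet_Ici)).2 (ae_nonneg_weightLaw w z q)

theorem IsBoundaryWeights.integrable_exp_sum {w z ε : ℝ} {ω : ℕ × ℕ → Ω → ℝ}
    (h : IsBoundaryWeights P w z ω) (hw : ε < w) (hz : ε < 1 - z) (h1 : ε < 1) (h0 : 0 < ε)
    (s : Finset (ℕ × ℕ)) : Integrable (fun x => Real.exp (ε * ∑ q ∈ s, |ω q x|)) P := by
  have hint : ∀ q, Integrable (fun x => Real.exp (ε * ω q x)) P := by
    intro q
    have : Integrable (fun x => Real.exp (ε * x)) (weightLaw w z q) := by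
      unfold weightLaw
      split_ifs
      · exact integrable_dirac (by simp)
      all_goals exact integrable_exp_expMeasure (by linarith) (by linarith)
    rw [← (h.hasLaw q).map_eq] at this
    exact this.comp_aemeasurable (h.aemeasurable q)
  have hae : ∀ᵐ x ∂P, ∀ q, (h.aemeasurable q).mk (ω q) x = ω q x :=
    ae_all_iff.2 fun q => (h.aemeasurable q).ae_eq_mk.symm
  have hmk : iIndepFun (fun q => (h.aemeasurable q).mk (ω q)) P :=
    h.indep.congr fun q => (h.aemeasurable q).ae_eq_mk
  have := hmk.integrable_exp_mul_sum (t := ε) (fun q => (h.aemeasurable q).measurable_mk) (s := s)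
    fun q _ => (hint q).congr (by filter_upwards [hae] with x hx; rw [hx])
  refine this.congr ?_
  filter_upwards [hae, h.ae_nonneg] with x hx hx0
  rw [Finset.sum_apply]
  congr 2
  exact Finset.sum_congr rfl fun q _ => by rw [hx, abs_of_nonneg (hx0 q)]

theorem IsBoundaryWeights.aemeasurable_G {w z : ℝ} {ω : ℕ × ℕ → Ω → ℝ}
    (h : IsBoundaryWeights P w z ω) (m n : ℕ) : AEMeasurable (G ω m n) P := by
  refine ⟨_, measurable_lastPassage (fun q => (h.aemeasurable q).measurable_mk) (m, n), ?_⟩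
  filter_upwards [ae_all_iff.2 fun q => (h.aemeasurable q).ae_eq_mk] with x hx
  simp only [G, hx]

theorem IsBoundaryWeights.ae_eq_lppRec {w z : ℝ} {ω : ℕ × ℕ → Ω → ℝ}
    (h : IsBoundaryWeights P w z ω) (m n : ℕ) :
    ∀ᵐ x ∂P, G ω m n x = lppRec (fun q => ω q x) m n := by
  filter_upwards [h.ae_nonneg] with x hx using lastPassage_eq_lppRec hx m n

theorem IsBoundaryWeights.integrable_pow {w z : ℝ} (hw : 0 < w) (hz : z < 1)
    {ω : ℕ × ℕ → Ω → ℝ} (h : IsBoundaryWeights P w z ω) (m n k : ℕ) (a : ℝ) :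
    Integrable (fun x => (G ω m n x - a) ^ k) P := by
  obtain ⟨ε, h0, hε⟩ := exists_between (lt_min hw (lt_min (sub_pos.2 hz) one_pos))
  rw [lt_min_iff, lt_min_iff] at hε
  set T : Ω → ℝ := fun x => ∑ q ∈ Finset.Icc (0, 0) (m, n), |ω q x| + |a| with hT
  have hTint : Integrable (fun x => Real.exp (ε * T x)) P := by
    simp only [hT, mul_add, Real.exp_add]
    exact (h.integrable_exp_sum hε.1 hε.2.1 hε.2.2 h0 _).mul_const _
  refine (integrable_pow_mul_exp_half h0 hTint k).mono'
    (((h.aemeasurable_G m n).sub_const a).pow_const k).aestronglyMeasurable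
    (.of_forall fun x => ?_)
  have hT0 : 0 ≤ T x := by positivity
  have h1 : |G ω m n x - a| ≤ |T x| := by
    rw [abs_of_nonneg hT0]
    exact (abs_sub _ _).trans (add_le_add (abs_lastPassage_le _ _) le_rfl)
  rw [norm_pow, Real.norm_eq_abs]
  refine (pow_le_pow_left₀ (abs_nonneg _) h1 k).trans (le_mul_of_one_le_right (by positivity) ?_)
  exact Real.one_le_exp (by positivity)

/-- The sum of the horizontal boundary weights. -/
noncomputable def horSum (x : ℕ × ℕ → ℝ) (m : ℕ) : ℝ := ∑ i ∈ Finset.range m, x (i + 1, 0)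

/-- The moment generating function of the increment along the right side of the rectangle. -/
theorem IsBoundaryWeights.integral_exp_G_sub_horSum {z t : ℝ} (hz : z ∈ Set.Ioo (0 : ℝ) 1)
    (ht : t < 1 - z) {ω : ℕ × ℕ → Ω → ℝ} (h : IsBoundaryWeights P z z ω) (m n : ℕ) :
    ∫ x, Real.exp (t * (G ω m n x - horSum (fun q => ω q x) m)) ∂P =
      ((1 - z) / (1 - z - t)) ^ n := by
  -- After all `m` columns are swept, the slots `(0, j + 1)` with `j < n` hold the increments along
  -- the right side, and they are still independent `Exp(1 - z)`.
  have hg := h.gridFlip hz n m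
  set η : ℕ × ℕ → Ω → ℝ := fun q x => ExpLPP.gridFlip n m (fun q => ω q x) q with hη
  have hae : ∀ᵐ x ∂P, G ω m n x - horSum (fun q => ω q x) m =
      (∑ j ∈ Finset.range n, fun x => η (0, j + 1) x) x := by
    filter_upwards [h.ae_eq_lppRec m n] with x hx
    rw [Finset.sum_apply, hη, sum_gridFlip, hx, lppRec_zero_right, h.origin, zero_add, horSum]
  have hmgf := (hg.indep.precomp (g := fun j : ℕ => (0, j + 1))
    (fun a b hab => by simpa using hab)).mgf_sum₀ (t := t)
    (fun j => hg.aemeasurable _) (Finset.range n)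
  rw [integral_congr_ae (g := fun x => Real.exp (t * (∑ j ∈ Finset.range n, η (0, j + 1)) x))
    (by filter_upwards [hae] with x hx; rw [hx])]
  refine hmgf.trans ?_
  rw [Finset.prod_congr rfl (g := fun _ => (1 - z) / (1 - z - t)), Finset.prod_const,
    Finset.card_range]
  intro j _
  rw [mgf, ← integral_exp_expMeasure (sub_pos.2 hz.2) ht]
  exact (hg.ver (j + 1) (Nat.succ_pos j)).integral_comp
    (f := fun x => Real.exp (t * x)) (by fun_prop)

/-- The likelihood ratio of the weight at `q` for the boundary parameters `w` and `z`. -/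
noncomputable def tilt (w z : ℝ) (q : ℕ × ℕ) (x : ℝ) : ℝ :=
  if q.2 = 0 ∧ q.1 ≠ 0 then w / z * Real.exp (-(w - z) * x) else 1

theorem measurable_tilt (w z : ℝ) (q : ℕ × ℕ) : Measurable (tilt w z q) := by
  unfold tilt
  split_ifs <;> fun_prop

theorem tilt_nonneg {w z : ℝ} (hw : 0 < w) (hz : 0 < z) (q : ℕ × ℕ) (x : ℝ) :
    0 ≤ tilt w z q x := by
  unfold tilt
  split_ifs <;> positivity

theorem weightLaw_eq_withDensity (w : ℝ) {z : ℝ} (hz : 0 < z) (q : ℕ × ℕ) :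
    weightLaw w z q = (weightLaw z z q).withDensity fun x => ENNReal.ofReal (tilt w z q x) := by
  unfold weightLaw tilt
  by_cases h2 : q.2 = 0 <;> by_cases h1 : q.1 = 0 <;> simp [h1, h2]
  simpa using expMeasure_eq_withDensity hz w

theorem prod_tilt (w z : ℝ) (x : ℕ × ℕ → ℝ) (m n : ℕ) :
    ∏ q ∈ Finset.Icc (0, 0) (m, n), tilt w z q (x q) =
      (w / z) ^ m * Real.exp (-(w - z) * horSum x m) := by
  have hinj : Function.Injective fun i : ℕ => (i + 1, 0) := fun a b hab => by simpa using hab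
  have hsub : (Finset.range m).image (fun i : ℕ => (i + 1, 0)) ⊆ Finset.Icc (0, 0) (m, n) := by
    intro q hq
    obtain ⟨i, hi, rfl⟩ := Finset.mem_image.1 hq
    simpa [Prod.le_def] using Finset.mem_range.1 hi
  rw [← Finset.prod_subset hsub, Finset.prod_image hinj.injOn]
  · simp only [tilt, ne_eq, Nat.add_eq_zero_iff, one_ne_zero, and_false, not_false_eq_true,
      and_self, if_true]
    rw [Finset.prod_mul_distrib, Finset.prod_const, Finset.card_range, ← Real.exp_sum, horSum,
      Finset.mul_sum]
  · intro q hq hq'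
    rw [tilt, if_neg]
    rintro ⟨h2, h1⟩
    refine hq' (Finset.mem_image.2 ⟨q.1 - 1, ?_, ?_⟩)
    · have := (Finset.mem_Icc.1 hq).2.1
      simp at this
      simp; omega
    · ext <;> simp <;> omega

/-- Change of measure in the horizontal boundary parameter. -/
theorem IsBoundaryWeights.integral_comp_G {w z : ℝ} (hw : 0 < w) (hz : z ∈ Set.Ioo (0 : ℝ) 1)
    {ω ω' : ℕ × ℕ → Ω → ℝ} (h : IsBoundaryWeights P z z ω) (h' : IsBoundaryWeights P w z ω')
    (m n : ℕ) {f : ℝ → ℝ} (hf : Measurable f) :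
    ∫ x, f (G ω' m n x) ∂P = (w / z) ^ m *
      ∫ x, f (G ω m n x) * Real.exp (-(w - z) * horSum (fun q => ω q x) m) ∂P := by
  classical
  set s : Finset (ℕ × ℕ) := Finset.Icc (0, 0) (m, n) with hs
  have := fun q : s => isProbabilityMeasure_weightLaw hw hz.2 q
  have := fun q : s => isProbabilityMeasure_weightLaw hz.1 hz.2 q
  -- Extension by zero makes the passage time a function of the finitely many weights in the
  -- rectangle, where a product density is available.
  let e : (s → ℝ) → ℕ × ℕ → ℝ := fun y q => if hq : q ∈ s then y ⟨q, hq⟩ else 0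
  have he : ∀ q, Measurable fun y => e y q := fun q => by
    by_cases hq : q ∈ s
    · simp only [e, hq, dif_pos]; fun_prop
    · simp only [e, hq, dif_neg, not_false_eq_true]; fun_prop
  let g : (s → ℝ) → ℝ := fun y => f (lastPassage (e y) (m, n))
  have hg : Measurable g := hf.comp (measurable_lastPassage he (m, n))
  have hGe : ∀ (η : ℕ × ℕ → Ω → ℝ) x, f (G η m n x) = g fun q => η q x := fun η x => by
    refine congrArg f (lastPassage_congr fun q hq => ?_)
    simp only [e]
    rw [dif_pos hq]
  have hlaw' : HasLaw (fun x (q : s) => ω' q x) (Measure.pi fun q : s => weightLaw w z q) P :=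
    (h'.indep.precomp Subtype.val_injective).hasLaw_pi fun q => h'.hasLaw q
  have hlaw : HasLaw (fun x (q : s) => ω q x) (Measure.pi fun q : s => weightLaw z z q) P :=
    (h.indep.precomp Subtype.val_injective).hasLaw_pi fun q => h.hasLaw q
  have hden : Measure.pi (fun q : s => weightLaw w z q) =
      (Measure.pi fun q : s => weightLaw z z q).withDensity
        fun y => ∏ q : s, ENNReal.ofReal (tilt w z q (y q)) := by
    have : ∀ q : s, SigmaFinite ((weightLaw z z q).withDensity
        fun x => ENNReal.ofReal (tilt w z q x)) := fun q => by
      rw [← weightLaw_eq_withDensity w hz.1]; infer_instance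
    rw [← Measure.pi_withDensity fun q : s => (measurable_tilt w z q).ennreal_ofReal]
    exact congrArg _ (funext fun q : s => weightLaw_eq_withDensity w hz.1 q)
  have hprod : ∀ y : s → ℝ, (∏ q : s, ENNReal.ofReal (tilt w z q (y q))).toReal =
      ∏ q : s, tilt w z q (y q) := fun y => by
    rw [ENNReal.toReal_prod]
    exact Finset.prod_congr rfl fun q _ => ENNReal.toReal_ofReal (tilt_nonneg hw hz.1 _ _)
  have hmt : ∀ q : s, Measurable fun y : s → ℝ => tilt w z q (y q) := fun q =>
    (measurable_tilt w z q).comp (measurable_pi_apply q)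
  calc ∫ x, f (G ω' m n x) ∂P = ∫ y, g y ∂Measure.pi fun q : s => weightLaw w z q := by
        simp_rw [hGe]
        exact hlaw'.integral_comp hg.aestronglyMeasurable
    _ = ∫ y, (∏ q : s, tilt w z q (y q)) * g y ∂Measure.pi fun q : s => weightLaw z z q := by
        rw [hden, integral_withDensity_eq_integral_toReal_smul]
        · simp_rw [hprod, smul_eq_mul]
        · exact Finset.measurable_fun_prod _ fun q _ => (hmt q).ennreal_ofReal
        · exact .of_forall fun y => ENNReal.prod_lt_top fun q _ => ENNReal.ofReal_lt_top
    _ = ∫ x, (∏ q : s, tilt w z q (ω q x)) * g (fun q => ω q x) ∂P :=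
        (hlaw.integral_comp ((Finset.measurable_fun_prod _ fun q _ => hmt q).mul
          hg).aestronglyMeasurable).symm
    _ = _ := by
        rw [← integral_const_mul]
        refine integral_congr_ae (.of_forall fun x => ?_)
        simp only
        rw [← hGe, Finset.prod_coe_sort s fun q => tilt w z q (ω q x), hs,
          prod_tilt w z (fun q => ω q x)]
        ring

end Moments

/-- Both products of binomials are the multinomial coefficient `p! / (k! * i! * (p - k - i)!)`. -/
theorem sum_choose_mul_sum_choose_comm (p : ℕ) (ρ : ℕ → ℝ) (a : ℕ → ℕ → ℝ) :
    ∑ k ∈ Finset.range (p + 1), (p.choose k : ℝ) * ∑ i ∈ Finset.range (p - k + 1),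
        ((p - k).choose i : ℝ) * ρ i * a k (p - k - i) =
      ∑ i ∈ Finset.range (p + 1), (p.choose i : ℝ) * ρ i * ∑ k ∈ Finset.range (p - i + 1),
        ((p - i).choose k : ℝ) * a k (p - i - k) := by
  simp_rw [Finset.mul_sum]
  rw [Finset.sum_comm' (t' := Finset.range (p + 1)) (s' := fun i => Finset.range (p - i + 1))]
  · refine Finset.sum_congr rfl fun i hi => Finset.sum_congr rfl fun k hk => ?_
    rw [Finset.mem_range] at hi hk
    have hc : (p.choose k : ℝ) * ((p - k).choose i : ℝ) =
        (p.choose i : ℝ) * ((p - i).choose k : ℝ) := by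
      rw [Nat.cast_choose ℝ (show k ≤ p by omega), Nat.cast_choose ℝ (show i ≤ p - k by omega),
        Nat.cast_choose ℝ (show i ≤ p by omega), Nat.cast_choose ℝ (show k ≤ p - i by omega),
        Nat.sub_right_comm p k i]
      have h1 := Nat.factorial_ne_zero (p - k)
      have h2 := Nat.factorial_ne_zero (p - i)
      field_simp
    rw [Nat.sub_right_comm p k i]
    linear_combination ρ i * a k (p - i - k) * hc
  · intro k i
    simp only [Finset.mem_range]
    omega

/-! ### The explicit function and its derivatives -/

section Tilted

/-- The product of the two boundary likelihood ratios, centred by the mean. -/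
noncomputable def tiltedMass (m n : ℕ) (z w : ℝ) : ℝ :=
  (w / z) ^ m * (Real.exp (-(w - z) * M m n z) * ((1 - z) / (1 - w)) ^ n)

theorem hasDerivAt_tiltedMass (m n : ℕ) {z w : ℝ} (hz : z ∈ Set.Ioo (0 : ℝ) 1)
    (hw : w ∈ Set.Ioo (0 : ℝ) 1) :
    HasDerivAt (tiltedMass m n z) ((M m n w - M m n z) * tiltedMass m n z w) w := by
  have hz0 := hz.1.ne'
  have hw0 := hw.1.ne'
  have hz1 : 1 - z ≠ 0 := (sub_pos.2 hz.2).ne'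
  have hw1 : 1 - w ≠ 0 := (sub_pos.2 hw.2).ne'
  have h1 := ((hasDerivAt_id w).div_const z).pow m
  have h2 := (((hasDerivAt_id w).sub_const z).neg.mul_const (M m n z)).exp
  have h3 := ((((hasDerivAt_id w).const_sub 1).inv hw1).const_mul (1 - z)).pow n
  have h := h1.mul (h2.mul h3)
  -- The truncated exponent `k - 1` is harmless at `k = 0` because of the factor `k`.
  have key : ∀ (k : ℕ) {x : ℝ}, x ≠ 0 → (k : ℝ) * x ^ (k - 1) = k * x ^ k / x := by
    intro k x hx
    rcases k with _ | k
    · simp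
    · rw [Nat.add_sub_cancel, pow_succ]; field_simp
  convert! h using 1
  simp only [id, Pi.pow_apply, Pi.mul_apply, Pi.inv_apply, Pi.neg_apply, tiltedMass,
    div_eq_mul_inv (1 - z)]
  rw [key m (div_ne_zero hw0 hz0), key n (mul_ne_zero hz1 (inv_ne_zero hw1))]
  generalize (w / z) ^ m = A
  generalize ((1 - z) * (1 - w)⁻¹) ^ n = B
  generalize Real.exp (-(w - z) * M m n z) = C
  rw [M]
  generalize M m n z = D
  field_simp
  ring

theorem contDiffAt_M (m n : ℕ) {z : ℝ} (hz : z ∈ Set.Ioo (0 : ℝ) 1) (k : ℕ) :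
    ContDiffAt ℝ k (M m n) z := by
  have h1 : 1 - z ≠ 0 := (sub_pos.2 hz.2).ne'
  have h0 := hz.1.ne'
  unfold M
  exact (contDiffAt_const.div contDiffAt_id h0).add
    (contDiffAt_const.div (contDiffAt_const.sub contDiffAt_id) h1)

theorem contDiffAt_tiltedMass (m n : ℕ) {z : ℝ} (hz : z ∈ Set.Ioo (0 : ℝ) 1) (k : ℕ) :
    ContDiffAt ℝ k (tiltedMass m n z) z := by
  have h1 : 1 - z ≠ 0 := (sub_pos.2 hz.2).ne'
  unfold tiltedMass
  refine ((contDiffAt_id.div_const z).pow m).mul (ContDiffAt.mul ?_ ?_)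
  · exact ((contDiffAt_id.sub contDiffAt_const).neg.mul contDiffAt_const).exp
  · exact (contDiffAt_const.div (contDiffAt_const.sub contDiffAt_id) h1).pow n

theorem iteratedDeriv_tiltedMass (m n p : ℕ) {z : ℝ} (hz : z ∈ Set.Ioo (0 : ℝ) 1) :
    iteratedDeriv p (tiltedMass m n z) z =
      (p ! : ℝ) * ∑ l : Nat.Partition p with ∀ i ∈ l.parts, 1 < i,
        faaDiBrunoCoeff l *
          (l.parts.map fun i => iteratedDeriv (i - 1) (fun t => M m n t) z).prod := by
  -- Derivatives at `z` of the logarithm of `tiltedMass`. The subtracted constant makes `d 1 = 0`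
  -- and does not affect the higher ones.
  set d : ℕ → ℝ := fun i => iteratedDeriv (i - 1) (fun w => M m n w - M m n z) z with hd
  have hd1 : d 1 = 0 := by simp [hd]
  have hdi : ∀ i, 1 < i → d i = iteratedDeriv (i - 1) (fun t => M m n t) z := by
    intro i hi
    obtain ⟨k, rfl⟩ : ∃ k, i = k + 2 := ⟨i - 2, by omega⟩
    simp only [hd, show k + 2 - 1 = k + 1 by omega, iteratedDeriv_succ', deriv_sub_const_fun]
  have h1 : tiltedMass m n z z = 1 := by
    have h1 : 1 - z ≠ 0 := (sub_pos.2 hz.2).ne'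
    simp [tiltedMass, div_self hz.1.ne', div_self h1]
  rw [eq_factorial_mul_partitionSum (h := fun p => iteratedDeriv p (tiltedMass m n z) z) (d := d)
    (by simpa using h1)]
  · congr 1
    rw [partitionSum, Finset.sum_filter]
    refine Finset.sum_congr rfl fun l _ => ?_
    rw [← faaDiBrunoCoeff_mul_prod]
    split_ifs with hl
    · rw [Multiset.map_congr rfl fun i hi => hdi i (hl i hi)]
    · push Not at hl
      obtain ⟨i, hi, hi1⟩ := hl
      have : i = 1 := le_antisymm hi1 (l.parts_pos hi)
      rw [Multiset.prod_eq_zero, mul_zero]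
      exact Multiset.mem_map.2 ⟨1, this ▸ hi, hd1⟩
  · intro p
    have hev : deriv (tiltedMass m n z) =ᶠ[𝓝 z]
        fun w => (M m n w - M m n z) * tiltedMass m n z w := by
      filter_upwards [isOpen_Ioo.mem_nhds hz] with w hw
      exact (hasDerivAt_tiltedMass m n hz hw).deriv
    rw [iteratedDeriv_succ', hev.iteratedDeriv_eq p,
      iteratedDeriv_fun_mul ((contDiffAt_M m n hz p).sub contDiffAt_const)
        (contDiffAt_tiltedMass m n hz p)]
    rfl

end Tilted

/-! ### The moment identity -/

section Main

variable {Ω : Type*} [MeasurableSpace Ω] {P : Measure Ω}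

theorem integrable_pow_mul_pow [IsFiniteMeasure P] {X S T : Ω → ℝ} {ε : ℝ}
    (hε : 0 < ε) (hT : Integrable (fun x => Real.exp (ε * T x)) P)
    (hX : AEStronglyMeasurable X P) (hS : AEStronglyMeasurable S P)
    (hXT : ∀ᵐ x ∂P, |X x| ≤ T x) (hST : ∀ᵐ x ∂P, |S x| ≤ T x) (k j : ℕ) :
    Integrable (fun x => X x ^ k * S x ^ j) P := by
  refine (integrable_pow_mul_exp_half hε hT (k + j)).mono' ((hX.pow k).mul (hS.pow j)) ?_
  filter_upwards [hXT, hST] with x hx hs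
  have hT1 : 0 ≤ T x := (abs_nonneg _).trans hx
  rw [norm_mul, norm_pow, norm_pow, Real.norm_eq_abs, Real.norm_eq_abs, pow_add, abs_of_nonneg hT1]
  refine le_trans ?_ (le_mul_of_one_le_right (by positivity) (Real.one_le_exp (by positivity)))
  gcongr

/-- The derivatives of the tilted moments at the base point. -/
theorem sum_choose_mul_iteratedDeriv [IsFiniteMeasure P] {X S T : Ω → ℝ} {ε z : ℝ} {ρ : ℝ → ℝ}
    {f : ℕ → ℝ → ℝ}
    (hε : 0 < ε) (hT : Integrable (fun x => Real.exp (ε * T x)) P)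
    (hX : AEStronglyMeasurable X P) (hS : AEStronglyMeasurable S P)
    (hXT : ∀ᵐ x ∂P, |X x| ≤ T x) (hST : ∀ᵐ x ∂P, |S x| ≤ T x)
    (hXST : ∀ᵐ x ∂P, |X x + S x| ≤ T x) (hρ : ∀ k : ℕ, ContDiffAt ℝ k ρ z)
    (hf : ∀ k, f k =ᶠ[𝓝 z] fun w => ρ w * ∫ x, X x ^ k * Real.exp ((w - z) * S x) ∂P) :
    (∀ k l : ℕ, ContDiffAt ℝ l (f k) z) ∧
    ∀ p : ℕ, ∑ k ∈ Finset.range (p + 1), (p.choose k : ℝ) * iteratedDeriv (p - k) (f k) z =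
      iteratedDeriv p (fun w => ρ w * ∫ x, Real.exp ((w - z) * (X x + S x)) ∂P) z := by
  have hz : z ∈ Metric.ball z (ε / 2) := Metric.mem_ball_self (by positivity)
  have hL := fun k j w hw => hasDerivAt_integral_pow_mul_exp hε hT hX hS hXT hST k j (z := z)
    (w := w) hw
  have hLd := fun k l => contDiffOn_of_ladder Metric.isOpen_ball (hL k) l 0
  have hLi := fun k j => iteratedDeriv_of_ladder Metric.isOpen_ball (hL k) j z hz
  have hR := fun j w hw => hasDerivAt_integral_pow_mul_exp hε hT hX (hX.add hS) hXT hXST 0 j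
    (z := z) (w := w) hw
  have hRd := fun l => contDiffOn_of_ladder Metric.isOpen_ball hR l 0
  have hRi := fun j => iteratedDeriv_of_ladder Metric.isOpen_ball hR j z hz
  simp only [pow_zero, mul_one, one_mul, sub_self, zero_mul, Real.exp_zero,
    Pi.add_apply] at hLd hLi hRd hRi
  have hLd' : ∀ k l : ℕ, ContDiffAt ℝ l
      (fun w => ∫ x, X x ^ k * Real.exp ((w - z) * S x) ∂P) z := fun k l =>
    (hLd k l).contDiffAt (Metric.isOpen_ball.mem_nhds hz)
  have hRd' : ∀ l : ℕ, ContDiffAt ℝ l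
      (fun w => ∫ x, Real.exp ((w - z) * (X x + S x)) ∂P) z := fun l =>
    (hRd l).contDiffAt (Metric.isOpen_ball.mem_nhds hz)
  refine ⟨fun k l => ((hρ l).mul (hLd' k l)).congr_of_eventuallyEq (hf k), fun p => ?_⟩
  have e1 : ∀ k ∈ Finset.range (p + 1), (p.choose k : ℝ) * iteratedDeriv (p - k) (f k) z =
      (p.choose k : ℝ) * ∑ i ∈ Finset.range (p - k + 1),
        ((p - k).choose i : ℝ) * iteratedDeriv i ρ z * ∫ x, X x ^ k * S x ^ (p - k - i) ∂P := by
    intro k _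
    rw [(hf k).iteratedDeriv_eq, iteratedDeriv_fun_mul (hρ _) (hLd' k _)]
    simp_rw [hLi]
  rw [Finset.sum_congr rfl e1,
    sum_choose_mul_sum_choose_comm p (fun i => iteratedDeriv i ρ z) fun k j =>
      ∫ x, X x ^ k * S x ^ j ∂P, iteratedDeriv_fun_mul (hρ _) (hRd' _)]
  refine Finset.sum_congr rfl fun i _ => ?_
  congr 1
  rw [hRi]
  -- After the exchange of sums, the inner sum is the binomial expansion of `(X + S) ^ (p - i)`.
  simp_rw [add_pow]
  rw [integral_finsetSum _ fun k _ =>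
    (integrable_pow_mul_pow hε hT hX hS hXT hST k _).mul_const _]
  refine Finset.sum_congr rfl fun k _ => ?_
  rw [integral_mul_const, mul_comm]

theorem IsBoundaryWeights.exists_integrable_exp [IsProbabilityMeasure P] {z : ℝ}
    (hz : z ∈ Set.Ioo (0 : ℝ) 1) {ω : ℕ × ℕ → Ω → ℝ} (h : IsBoundaryWeights P z z ω)
    (m n : ℕ) (a : ℝ) :
    ∃ ε > 0, ∃ T : Ω → ℝ, Integrable (fun x => Real.exp (ε * T x)) P ∧
      (∀ x, |G ω m n x - a| ≤ T x) ∧ (∀ x, |-horSum (fun q => ω q x) m| ≤ T x) ∧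
      ∀ x, |G ω m n x - a + -horSum (fun q => ω q x) m| ≤ T x := by
  obtain ⟨ε, h0, hε⟩ := exists_between (lt_min hz.1 (lt_min (sub_pos.2 hz.2) one_pos))
  rw [lt_min_iff, lt_min_iff] at hε
  set A : Ω → ℝ := fun x => ∑ q ∈ Finset.Icc (0, 0) (m, n), |ω q x| with hA
  have hG : ∀ x, |G ω m n x - a| ≤ A x + |a| := fun x =>
    (abs_sub _ _).trans (add_le_add (abs_lastPassage_le _ _) le_rfl)
  have hS : ∀ x, |-horSum (fun q => ω q x) m| ≤ A x := fun x => by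
    rw [abs_neg, horSum]
    refine (Finset.abs_sum_le_sum_abs _ _).trans ?_
    have hinj : Function.Injective fun i : ℕ => (i + 1, 0) := fun a b hab => by simpa using hab
    rw [← Finset.sum_image (s := Finset.range m) (f := fun q => |ω q x|) hinj.injOn]
    refine Finset.sum_le_sum_of_subset_of_nonneg (fun q hq => ?_) fun q _ _ => abs_nonneg _
    obtain ⟨i, hi, rfl⟩ := Finset.mem_image.1 hq
    simpa [Prod.le_def] using Finset.mem_range.1 hi
  have hA0 : ∀ x, 0 ≤ A x := fun x => Finset.sum_nonneg fun q _ => abs_nonneg _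
  -- The bound must also cover the sum of the two variables, which costs a factor `2` on `A`;
  -- halving `ε` pays for it.
  refine ⟨ε / 2, by positivity, fun x => 2 * A x + |a|, ?_, fun x => ?_, fun x => ?_,
    fun x => ?_⟩
  · have := (h.integrable_exp_sum hε.1 hε.2.1 hε.2.2 h0 (Finset.Icc (0, 0) (m, n))).mul_const
      (Real.exp (ε / 2 * |a|))
    refine this.congr (.of_forall fun x => ?_)
    simp only [← Real.exp_add, hA]
    ring_nf
  · linarith [hG x, hA0 x]
  · linarith [hS x, hA0 x, abs_nonneg a]
  · linarith [abs_add_le (G ω m n x - a) (-horSum (fun q => ω q x) m), hG x, hS x]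

theorem IsBoundaryWeights.aemeasurable_horSum [IsProbabilityMeasure P] {w z : ℝ}
    {ω : ℕ × ℕ → Ω → ℝ} (h : IsBoundaryWeights P w z ω) (m : ℕ) :
    AEMeasurable (fun x => horSum (fun q => ω q x) m) P :=
  Finset.aemeasurable_fun_sum _ fun i _ => h.aemeasurable (i + 1, 0)

theorem moment_identity [IsProbabilityMeasure P] (ω : ℝ → ℕ × ℕ → Ω → ℝ) {z : ℝ}
    (hz : z ∈ Set.Ioo (0 : ℝ) 1) (hω : ∀ w, 0 < w → IsBoundaryWeights P w z (ω w)) (m n : ℕ) :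
    (∀ k l : ℕ, ContDiffAt ℝ l (fun w => ∫ x, (G (ω w) m n x - M m n z) ^ k ∂P) z) ∧
    ∀ p : ℕ, 0 < p → ∫ x, (G (ω z) m n x - M m n z) ^ p ∂P =
      iteratedDeriv p (tiltedMass m n z) z - ∑ k ∈ Finset.Icc 1 (p - 1), (p.choose k : ℝ) *
        iteratedDeriv (p - k) (fun w => ∫ x, (G (ω w) m n x - M m n z) ^ k ∂P) z := by
  have h := hω z hz.1
  obtain ⟨ε, hε, T, hT, hXT, hST, hXST⟩ := h.exists_integrable_exp hz m n (M m n z)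
  have hpos : ∀ᶠ w in 𝓝 z, w ∈ Set.Ioo (0 : ℝ) 1 := isOpen_Ioo.mem_nhds hz
  have hf : ∀ k : ℕ, (fun w => ∫ x, (G (ω w) m n x - M m n z) ^ k ∂P) =ᶠ[𝓝 z] fun w =>
      (w / z) ^ m * ∫ x, (G (ω z) m n x - M m n z) ^ k *
        Real.exp ((w - z) * -horSum (fun q => ω z q x) m) ∂P := by
    intro k
    filter_upwards [hpos] with w hw
    rw [h.integral_comp_G hw.1 hz (hω w hw.1) m n (f := fun y => (y - M m n z) ^ k) (by fun_prop)]
    simp only [neg_mul, mul_neg]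
  obtain ⟨hsm, hsum⟩ := sum_choose_mul_iteratedDeriv (ρ := fun w => (w / z) ^ m) hε hT
    ((h.aemeasurable_G m n).sub_const _).aestronglyMeasurable
    (h.aemeasurable_horSum m).neg.aestronglyMeasurable (.of_forall hXT) (.of_forall hST)
    (.of_forall hXST) (fun k => (contDiffAt_id.div_const z).pow m) hf
  refine ⟨hsm, fun p hp => ?_⟩
  -- The horizontal sum in `S` cancels the bottom side of the path to `(m, n)`, leaving the
  -- right-side increment, whose moment generating function at `w - z` is known.
  have hH : (fun w => (w / z) ^ m * ∫ x, Real.exp ((w - z) *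
      (G (ω z) m n x - M m n z + -horSum (fun q => ω z q x) m)) ∂P) =ᶠ[𝓝 z]
      tiltedMass m n z := by
    filter_upwards [hpos] with w hw
    rw [tiltedMass]
    congr 1
    have h1 := h.integral_exp_G_sub_horSum hz (t := w - z) (by linarith [hw.2]) m n
    rw [show 1 - z - (w - z) = 1 - w by ring] at h1
    rw [← h1, ← integral_const_mul]
    refine integral_congr_ae (.of_forall fun x => ?_)
    simp only
    rw [← Real.exp_add]
    ring_nf
  have hp1 := hsum p
  simp only [Pi.neg_apply] at hp1
  rw [hH.iteratedDeriv_eq] at hp1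
  obtain ⟨r, rfl⟩ := Nat.exists_eq_succ_of_ne_zero hp.ne'
  have h0 : iteratedDeriv (r + 1) (fun w => ∫ x, (G (ω w) m n x - M m n z) ^ 0 ∂P) z = 0 := by
    simp [iteratedDeriv_const]
  rw [Finset.sum_range_succ, Finset.sum_range_succ'] at hp1
  simp only [Nat.succ_eq_add_one, Nat.sub_zero, h0, mul_zero, add_zero, Nat.choose_self,
    Nat.cast_one, one_mul, Nat.sub_self, iteratedDeriv_zero] at hp1
  rw [← hp1, Nat.succ_eq_add_one, Nat.add_sub_cancel,
    ← Finset.sum_image (s := Finset.range r) (g := fun k => k + 1)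
      (f := fun k => ((r + 1).choose k : ℝ) *
        iteratedDeriv (r + 1 - k) (fun w => ∫ x, (G (ω w) m n x - M m n z) ^ k ∂P) z)
      (by simp)]
  have : (Finset.range r).image (fun k => k + 1) = Finset.Icc 1 r := by
    ext k
    simp only [Finset.mem_image, Finset.mem_range, Finset.mem_Icc]
    exact ⟨fun ⟨a, _, _⟩ => by omega, fun _ => ⟨k - 1, by omega⟩⟩
  rw [this, add_sub_cancel_left]

/-- For `p = 1` the correction sum is empty, and `tiltedMass` has derivative `0` at `z`. -/
theorem integral_G [IsProbabilityMeasure P] (ω : ℝ → ℕ × ℕ → Ω → ℝ) {z : ℝ}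
    (hz : z ∈ Set.Ioo (0 : ℝ) 1) (hω : ∀ w, 0 < w → IsBoundaryWeights P w z (ω w)) (m n : ℕ) :
    ∫ x, G (ω z) m n x ∂P = M m n z := by
  have h1 := (moment_identity ω hz hω m n).2 1 one_pos
  have hint : Integrable (G (ω z) m n) P := by
    simpa using (hω z hz.1).integrable_pow hz.1 hz.2 m n 1 0
  have h2 : iteratedDeriv 1 (tiltedMass m n z) z = 0 := by
    rw [iteratedDeriv_one, (hasDerivAt_tiltedMass m n hz hz).deriv]
    simp
  rw [h2] at h1
  simp only [pow_one] at h1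
  rw [integral_sub hint (integrable_const _)] at h1
  simpa [sub_eq_zero] using h1

end Main

end ExpLPP

open MeasureTheory ProbabilityTheory ExpLPP in
theorem propositionC1 {Ω : Type*} [MeasurableSpace Ω] (P : Measure Ω) [IsProbabilityMeasure P]
    (ω : ℝ → ℝ → ℕ × ℕ → Ω → ℝ)
    (hω : ∀ a b : ℝ, 0 < a → b < 1 → IsBoundaryWeights P a b (ω a b))
    (m n p : ℕ) (hm : 0 < m) (hn : 0 < n) (hp : 0 < p) (z : ℝ) (hz : z ∈ Set.Ioo (0 : ℝ) 1) :
    (∀ w : ℝ, 0 < w → ∀ k : ℕ, ∀ a : ℝ, Integrable (fun x => (G (ω w z) m n x - a) ^ k) P) ∧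
    (∀ k ∈ Finset.Icc 1 (p - 1),
      ContDiffAt ℝ ((p - k : ℕ)) (fun w => ∫ x, (G (ω w z) m n x - M m n z) ^ k ∂P) z) ∧
    ∫ x, (G (ω z z) m n x - ∫ y, G (ω z z) m n y ∂P) ^ p ∂P =
      (p.factorial : ℝ) *
          ∑ l : Nat.Partition p with ∀ i ∈ l.parts, 1 < i,
            faaDiBrunoCoeff l *
              (l.parts.map fun i => iteratedDeriv (i - 1) (fun t => M m n t) z).prod
        - ∑ k ∈ Finset.Icc 1 (p - 1),
            (p.choose k : ℝ) *
              iteratedDeriv (p - k)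
                (fun w => ∫ x, (G (ω w z) m n x - M m n z) ^ k ∂P) z := by
  have h := fun w hw => hω w z hw hz.2
  obtain ⟨hsm, hid⟩ := moment_identity (fun w => ω w z) hz h m n
  refine ⟨fun w hw k a => (h w hw).integrable_pow hw hz.2 m n k a, fun k _ => hsm k _, ?_⟩
  rw [integral_G (fun w => ω w z) hz h m n, hid p hp, iteratedDeriv_tiltedMass m n p hz]
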